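/- Let $p\in[1,2]$. For $A\in\mathbb{R}^{n\times d}$ with rows $a_1^\top,\dots,a_n^\top$, the $\ell_p$ Lewis weights $w_1(A),\dots,w_n(A)$ are the unique nonnegative real numbers, positive for nonzero rows, such that \[ w_i(A)=\bigl(a_i^\top(A^\top W^{1-2/p}A)^{\dagger}a_i\bigr)^{p/2},\qquad W=\operatorname{diag}(w_1(A),\dots,w_n(A)), \] where $\dagger$ is the Moore–Penrose pseudoinverse (zero rows have weight $0$ and do not contribute to $A^\top W^{1-2/p}A$). Given $p_1,\dots,p_n\in[0,1]$, the rescaled sampling matrix with respect to $p_1,\dots,p_n$ is obtained as follows: sample each index $i\in[n]$ independently with probability $p_i$, form the diagonal matrix $D$ with $D_{ii}=p_i^{-1/p}$ if $i$ is sampled and $D_{ii}=0$ otherwise, and delete the rows of $D$ whose index was not sampled. Write $X\circ Y$ for vertical concatenation. There is an absolute constant $C>0$ such that the following holds. Let $A_i\in\mathbb{R}^{n_i\times d}$ $(i=1,\dots,r)$, $B\in\mathbb{R}^{k\times d}$ and $M=A_1\circ\cdots\circ A_r\circ B$. Let $\eta,\delta\in(0,1)$ with $d/\delta\ge 2$ (which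 is automatic for $d\ge 2$), and let $\beta\ge C\eta^{-2}\log(d/\delta)$. For each $i\in[r]$, let $S_i\in\mathbb{R}^{m_i\times n_i}$ be the rescaled sampling matrix with respect to $p_{i,1},\dots,p_{i,n_i}$, where $\min\{\beta w_j(A_i),1\}\le p_{i,j}\le 1$ for each $j\in[n_i]$; the matrices $S_1,\dots,S_r$ are independent. Let $M'=S_1A_1\circ\cdots\circ S_rA_r\circ B$. Then, with probability at least $1-\delta$, the following two statements hold simultaneously. \begin{enumerate} \item For each $i\in[r]$ and each $j\in[m_i]$, with $s_i(j)\in[n_i]$ the column of the nonzero entry in row $j$ of $S_i$, \[ (1-\eta)\frac{w_{n_1+\cdots+n_{i-1}+s_i(j)}(M)}{p_{i,s_i(j)}}\le w_{m_1+\cdots+m_{i-1}+j}(M')\le(1+\eta)\frac{w_{n_1+\cdots+n_{i-1}+s_i(j)}(M)}{p_{i,s_i(j)}}. \] \item For each $j=1,\dots,k$, \[ (1-\eta)w_{n_1+\cdots+n_r+j}(M)\le w_{m_1+\cdots+m_r+j}(M')\le(1+\eta)w_{n_1+\cdots+n_r+j}(M). \] \end{enumerate} -/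

import Mathlib

open MeasureTheory ProbabilityTheory Matrix

/-- The four Penrose equations: `X` is the Moore-Penrose pseudoinverse of the real matrix `G`. -/
structure IsPseudoinverse {m n : Type*} [Fintype m] [Fintype n]
    (G : Matrix m n ℝ) (X : Matrix n m ℝ) : Prop where
  mul_mul_left : G * X * G = G
  mul_mul_right : X * G * X = X
  symm_left : (G * X)ᵀ = G * X
  symm_right : (X * G)ᵀ = X * G

theorem IsPseudoinverse.unique {m n : Type*} [Fintype m] [Fintype n]
    {G : Matrix m n ℝ} {X Y : Matrix n m ℝ}
    (hX : IsPseudoinverse G X) (hY : IsPseudoinverse G Y) : X = Y := by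
  have h1 : G * X = G * Y := by
    calc G * X = (G * Y * G) * X := by rw [hY.mul_mul_left]
      _ = (G * Y)ᵀ * (G * X)ᵀ := by rw [hY.symm_left, hX.symm_left]; simp only [Matrix.mul_assoc]
      _ = (G * X * G * Y)ᵀ := by rw [← transpose_mul]; simp only [Matrix.mul_assoc]
      _ = G * Y := by rw [hX.mul_mul_left, hY.symm_left]
  have h2 : X * G = Y * G := by
    calc X * G = X * (G * Y * G) := by rw [hY.mul_mul_left]
      _ = (X * G)ᵀ * (Y * G)ᵀ := by rw [hY.symm_right, hX.symm_right]; simp only [Matrix.mul_assoc]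
      _ = (Y * (G * X * G))ᵀ := by rw [← transpose_mul]; simp only [Matrix.mul_assoc]
      _ = Y * G := by rw [hX.mul_mul_left, hY.symm_right]
  calc X = X * G * X := hX.mul_mul_right.symm
    _ = Y * (G * X) := by rw [h2, Matrix.mul_assoc]
    _ = Y := by rw [h1, ← Matrix.mul_assoc, hY.mul_mul_right]

theorem exists_isPseudoinverse_of_isSymm {n : Type*} [Fintype n]
    {G : Matrix n n ℝ} (hG : Gᵀ = G) : ∃ X, IsPseudoinverse G X := by
  classical
  have hH : G.IsHermitian := by
    rw [Matrix.IsHermitian, conjTranspose_eq_transpose_of_trivial, hG]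
  obtain ⟨U, l, hU, hGU⟩ : ∃ (U : Matrix n n ℝ) (l : n → ℝ),
      Uᵀ * U = 1 ∧ G = U * diagonal l * Uᵀ := by
    refine ⟨hH.eigenvectorUnitary, hH.eigenvalues, ?_, ?_⟩
    · have := Unitary.coe_star_mul_self hH.eigenvectorUnitary
      rwa [star_eq_conjTranspose, conjTranspose_eq_transpose_of_trivial] at this
    · have := hH.spectral_theorem
      rw [Unitary.conjStarAlgAut_apply, star_eq_conjTranspose,
        conjTranspose_eq_transpose_of_trivial] at this
      exact this
  have key : ∀ a b : n → ℝ, (U * diagonal a * Uᵀ) * (U * diagonal b * Uᵀ)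
      = U * diagonal (a * b) * Uᵀ := by
    intro a b
    calc (U * diagonal a * Uᵀ) * (U * diagonal b * Uᵀ)
        = U * diagonal a * (Uᵀ * U) * diagonal b * Uᵀ := by simp only [Matrix.mul_assoc]
      _ = U * diagonal (a * b) * Uᵀ := by
        rw [hU, Matrix.mul_one, Matrix.mul_assoc U, diagonal_mul_diagonal]; rfl
  have ksymm : ∀ a : n → ℝ, (U * diagonal a * Uᵀ)ᵀ = U * diagonal a * Uᵀ := by
    intro a
    simp [Matrix.mul_assoc]
  refine ⟨U * diagonal l⁻¹ * Uᵀ, ?_, ?_, ?_, ?_⟩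
  · rw [hGU, key, key]
    congr 3; ext i; by_cases h : l i = 0 <;> simp [h]
  · rw [hGU, key, key]
    congr 3; ext i; by_cases h : l i = 0 <;> simp [h]
  · rw [hGU, key, ksymm]
  · rw [hGU, key, ksymm]

theorem IsPseudoinverse.transpose {m n : Type*} [Fintype m] [Fintype n]
    {G : Matrix m n ℝ} {X : Matrix n m ℝ} (h : IsPseudoinverse G X) :
    IsPseudoinverse Gᵀ Xᵀ where
  mul_mul_left := by
    simpa only [transpose_mul, Matrix.mul_assoc] using congrArg Matrix.transpose h.mul_mul_left
  mul_mul_right := by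
    simpa only [transpose_mul, Matrix.mul_assoc] using congrArg Matrix.transpose h.mul_mul_right
  symm_left := by rw [← transpose_mul, h.symm_right, h.symm_right]
  symm_right := by rw [← transpose_mul, h.symm_left, h.symm_left]

theorem exists_isPseudoinverse {m n : Type*} [Fintype m] [Fintype n]
    (A : Matrix m n ℝ) : ∃ X, IsPseudoinverse A X := by
  classical
  have hs : (Aᵀ * A)ᵀ = Aᵀ * A := by simp
  obtain ⟨Y, hY⟩ := exists_isPseudoinverse_of_isSymm hs
  have hYs : Yᵀ = Y := by
    have h := hY.transpose
    rw [hs] at h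
    exact h.unique hY
  have h0 : A * (Y * (Aᵀ * A) - 1) = 0 := by
    rw [← conjTranspose_mul_self_mul_eq_zero, conjTranspose_eq_transpose_of_trivial,
      Matrix.mul_sub, ← Matrix.mul_assoc, hY.mul_mul_left, Matrix.mul_one, sub_self]
  refine ⟨Y * Aᵀ, ?_, ?_, ?_, ?_⟩
  · rw [Matrix.mul_sub, Matrix.mul_one, sub_eq_zero] at h0
    simpa only [Matrix.mul_assoc] using h0
  · have h := congrArg (· * Aᵀ) hY.mul_mul_right
    simpa only [Matrix.mul_assoc] using h
  · simp only [transpose_mul, transpose_transpose, hYs, Matrix.mul_assoc]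
  · have h := hY.symm_right
    rwa [← Matrix.mul_assoc] at h

/-- The Moore-Penrose pseudoinverse of a real matrix. -/
noncomputable def pseudoinverse {m n : Type*} [Fintype m] [Fintype n]
    (G : Matrix m n ℝ) : Matrix n m ℝ :=
  Classical.choose (exists_isPseudoinverse G)

theorem isPseudoinverse_pseudoinverse {m n : Type*} [Fintype m] [Fintype n]
    (G : Matrix m n ℝ) : IsPseudoinverse G (pseudoinverse G) :=
  Classical.choose_spec (exists_isPseudoinverse G)

/-- The defining equations `w i = (aᵢᵀ (Aᵀ W ^ (1 - 2 / p) A)† aᵢ) ^ (p / 2)` of the `ℓ_p` Lewis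
weights of `A`, where `aᵢ` is the `i`-th row of `A` and `W = diag w`. The exponent `1 - 2 / p` is
negative for `p < 2`, so the equations only make sense if the weights of the nonzero rows are
positive; this is the first condition. A zero row has weight zero and, whatever value the power
takes there, contributes nothing to `Aᵀ W ^ (1 - 2 / p) A`. -/
def IsLewisWeights {m n : Type*} [Fintype m] [Fintype n] [DecidableEq m]
    (p : ℝ) (A : Matrix m n ℝ) (w : m → ℝ) : Prop :=
  (∀ i, A i ≠ 0 → 0 < w i) ∧
  ∀ i, w i =
    (A i ⬝ᵥ (pseudoinverse (Aᵀ * diagonal (fun l => w l ^ (1 - 2 / p)) * A) *ᵥ A i)) ^ (p / 2)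

/-- The `ℓ_p` Lewis weights of the rows of `A`, that is, the solution of `IsLewisWeights p A`
(for `1 ≤ p ≤ 2` there is exactly one). -/
noncomputable def lewisWeights {m n : Type*} [Fintype m] [Fintype n] [DecidableEq m]
    (p : ℝ) (A : Matrix m n ℝ) : m → ℝ :=
  Classical.epsilon (IsLewisWeights p A)

/-- The vertical concatenation `A₁ ∘ ⋯ ∘ A_r ∘ B`. The row `Sum.inl ⟨i, j⟩` is the `j`-th row of
the block `A i`, and the row `Sum.inr j` is the `j`-th row of `B`. -/
def vconcat {r k d : ℕ} {ι : Fin r → Type} (A : ∀ i, Matrix (ι i) (Fin d) ℝ)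
    (B : Matrix (Fin k) (Fin d) ℝ) : Matrix ((Σ i, ι i) ⊕ Fin k) (Fin d) ℝ :=
  Matrix.fromRows (Matrix.of fun x : Σ i, ι i => A x.1 x.2) B

/-- The rescaled sampling matrix with respect to the probabilities `q`, when `T` is the set of
sampled indices: the diagonal matrix with entries `q j ^ (-1 / p)` for `j ∈ T` and `0` for `j ∉ T`,
of which only the rows with index in `T` are kept. The row with index `j : T` has its nonzero
entry in the column `(j : Fin n)`. -/
noncomputable def rescaledSamplingMatrix {n : ℕ} (p : ℝ) (q : Fin n → ℝ) (T : Finset (Fin n)) :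
    Matrix T (Fin n) ℝ :=
  (diagonal fun j => if j ∈ T then q j ^ (-(1 / p)) else 0).submatrix (fun j : T => (j : Fin n)) id

/-- `E x` is the event that the index `x` is sampled. Indices are sampled independently, and `x`
is sampled with probability `q x`. -/
structure IsIndependentSampling {Ω ι : Type*} [MeasurableSpace Ω] (μ : Measure Ω)
    (q : ι → ℝ) (E : ι → Set Ω) : Prop where
  measurableSet : ∀ x, MeasurableSet (E x)
  prob : ∀ x, μ.real (E x) = q x
  indep : iIndepSet E μ

/-- The random set of the indices that are sampled at the outcome `ω`. -/
noncomputable def sampledIndices {Ω : Type*} {n : ℕ} (E : Fin n → Set Ω) (ω : Ω) :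
    Finset (Fin n) := by
  classical exact Finset.univ.filter fun j => ω ∈ E j

set_option linter.unusedSectionVars false

section LeverageScores

variable {m n : Type*} [Fintype m] [Fintype n] [DecidableEq m]

/-- The leverage score of the `i`-th row of `A` with respect to the weighted Gram matrix
`Aᵀ diag(c) A`. -/
noncomputable def leverageScore (A : Matrix m n ℝ) (c : m → ℝ) (i : m) : ℝ :=
  A i ⬝ᵥ (pseudoinverse (Aᵀ * diagonal c * A) *ᵥ A i)

theorem gram_mulVec_dotProduct (A : Matrix m n ℝ) (c : m → ℝ) (x y : n → ℝ) :
    ((Aᵀ * diagonal c * A) *ᵥ y) ⬝ᵥ x = ∑ l, c l * (A l ⬝ᵥ y) * (A l ⬝ᵥ x) := by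
  rw [dotProduct_comm, ← mulVec_mulVec, ← mulVec_mulVec, dotProduct_mulVec, vecMul_transpose,
    dotProduct]
  refine Finset.sum_congr rfl fun l _ => ?_
  rw [mulVec_diagonal]
  simp only [mulVec]
  ring

theorem gram_transpose (A : Matrix m n ℝ) (c : m → ℝ) :
    (Aᵀ * diagonal c * A)ᵀ = Aᵀ * diagonal c * A := by
  simp [Matrix.mul_assoc]

theorem pseudoinverse_transpose_of_isSymm {G : Matrix n n ℝ} (hG : Gᵀ = G) :
    (pseudoinverse G)ᵀ = pseudoinverse G := by
  have h := (isPseudoinverse_pseudoinverse G).transpose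
  rw [hG] at h
  exact h.unique (isPseudoinverse_pseudoinverse G)

variable {A : Matrix m n ℝ} {c : m → ℝ}

theorem weighted_sq_nonneg (hc : ∀ l, A l ≠ 0 → 0 < c l) (x : n → ℝ) (l : m) :
    0 ≤ c l * (A l ⬝ᵥ x) ^ 2 := by
  by_cases h : A l = 0
  · simp [h]
  · exact mul_nonneg (hc l h).le (sq_nonneg _)

theorem gram_mulVec_pseudoinverse_row (hc : ∀ l, A l ≠ 0 → 0 < c l) (i : m) :
    (Aᵀ * diagonal c * A) *ᵥ (pseudoinverse (Aᵀ * diagonal c * A) *ᵥ A i) = A i := by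
  by_cases hi : A i = 0
  · simp [hi]
  set G := Aᵀ * diagonal c * A with hG
  have hP := isPseudoinverse_pseudoinverse G
  set P := pseudoinverse G
  refine dotProduct_eq _ _ fun x => ?_
  have h0 : G *ᵥ (x - (P * G) *ᵥ x) = 0 := by
    rw [mulVec_sub, mulVec_mulVec, ← Matrix.mul_assoc, hP.mul_mul_left, sub_self]
  have h1 := gram_mulVec_dotProduct A c (x - (P * G) *ᵥ x) (x - (P * G) *ᵥ x)
  rw [← hG, h0, zero_dotProduct] at h1
  have h2 := (Finset.sum_eq_zero_iff_of_nonneg (s := Finset.univ)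
    (f := fun l => c l * (A l ⬝ᵥ (x - (P * G) *ᵥ x)) * (A l ⬝ᵥ (x - (P * G) *ᵥ x)))
    fun l _ => by
      have := weighted_sq_nonneg hc (x - (P * G) *ᵥ x) l
      rwa [pow_two, ← mul_assoc] at this).1 h1.symm i (Finset.mem_univ i)
  have h3 : A i ⬝ᵥ (x - (P * G) *ᵥ x) = 0 := by
    have := (hc i hi).ne'
    simpa [this] using h2
  rw [dotProduct_sub, sub_eq_zero] at h3
  have h4 : (G * P)ᵀ = P * G := by rw [hP.symm_left]; rw [← hP.symm_right, transpose_mul,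
    pseudoinverse_transpose_of_isSymm (gram_transpose A c), hG, gram_transpose]
  rw [h3, mulVec_mulVec, ← vecMul_transpose, h4, ← dotProduct_mulVec]

theorem leverageScore_eq_sum (hc : ∀ l, A l ≠ 0 → 0 < c l) (i : m) :
    leverageScore A c i = ∑ l, c l *
      (A l ⬝ᵥ (pseudoinverse (Aᵀ * diagonal c * A) *ᵥ A i)) ^ 2 := by
  conv_lhs => rw [leverageScore, ← gram_mulVec_pseudoinverse_row hc i]
  rw [gram_mulVec_pseudoinverse_row hc i, ← gram_mulVec_pseudoinverse_row hc i,
    gram_mulVec_dotProduct, gram_mulVec_pseudoinverse_row hc i]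
  exact Finset.sum_congr rfl fun l _ => by ring

theorem leverageScore_nonneg (hc : ∀ l, A l ≠ 0 → 0 < c l) (i : m) : 0 ≤ leverageScore A c i := by
  rw [leverageScore_eq_sum hc]
  exact Finset.sum_nonneg fun l _ => weighted_sq_nonneg hc _ l

theorem sq_dotProduct_le_leverageScore_mul (hc : ∀ l, A l ≠ 0 → 0 < c l) (i : m) (x : n → ℝ) :
    (A i ⬝ᵥ x) ^ 2 ≤ leverageScore A c i * ∑ l, c l * (A l ⬝ᵥ x) ^ 2 := by
  conv_lhs => rw [← gram_mulVec_pseudoinverse_row hc i, gram_mulVec_dotProduct]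
  rw [leverageScore_eq_sum hc]
  refine Finset.sum_sq_le_sum_mul_sum_of_sq_le_mul _ (fun l _ => weighted_sq_nonneg hc _ l)
    (fun l _ => weighted_sq_nonneg hc _ l) fun l _ => le_of_eq (by ring)

theorem leverageScore_le (hc : ∀ l, A l ≠ 0 → 0 < c l) {i : m} {t : ℝ} (ht : 0 ≤ t)
    (h : ∀ x, (A i ⬝ᵥ x) ^ 2 ≤ t * ∑ l, c l * (A l ⬝ᵥ x) ^ 2) : leverageScore A c i ≤ t := by
  have h1 := h (pseudoinverse (Aᵀ * diagonal c * A) *ᵥ A i)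
  rw [← leverageScore_eq_sum hc] at h1
  change leverageScore A c i ^ 2 ≤ _ at h1
  rcases (leverageScore_nonneg hc i).eq_or_lt with h0 | h0
  · rwa [← h0]
  · nlinarith

theorem leverageScore_pos (hc : ∀ l, A l ≠ 0 → 0 < c l) {i : m} (hi : A i ≠ 0) :
    0 < leverageScore A c i := by
  refine (leverageScore_nonneg hc i).lt_of_ne fun h => hi ?_
  refine dotProduct_eq _ _ fun x => ?_
  have := sq_dotProduct_le_leverageScore_mul hc i x
  rw [← h, zero_mul] at this
  rw [zero_dotProduct]
  exact pow_eq_zero_iff (two_ne_zero) |>.1 (le_antisymm this (sq_nonneg _))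

theorem gram_congr {c' : m → ℝ} (h : ∀ l, A l ≠ 0 → c l = c' l) :
    Aᵀ * diagonal c * A = Aᵀ * diagonal c' * A := by
  ext a b
  rw [Matrix.mul_apply, Matrix.mul_apply]
  refine Finset.sum_congr rfl fun l _ => ?_
  rw [mul_diagonal, mul_diagonal]
  by_cases hl : A l = 0
  · simp [show A l b = 0 from congrFun hl b]
  · rw [h l hl]

theorem leverageScore_congr {c' : m → ℝ} (h : ∀ l, A l ≠ 0 → c l = c' l) :
    leverageScore A c = leverageScore A c' := by
  funext i
  rw [leverageScore, gram_congr h, leverageScore]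

theorem leverageScore_le_mul {c' : m → ℝ} (hc : ∀ l, A l ≠ 0 → 0 < c l)
    (hc' : ∀ l, A l ≠ 0 → 0 < c' l) {t : ℝ} (ht : 0 ≤ t) (h : ∀ l, A l ≠ 0 → c' l ≤ t * c l)
    (i : m) : leverageScore A c i ≤ t * leverageScore A c' i := by
  refine leverageScore_le hc (mul_nonneg ht (leverageScore_nonneg hc' i)) fun x => ?_
  refine (sq_dotProduct_le_leverageScore_mul hc' i x).trans ?_
  rw [mul_comm t, mul_assoc, Finset.mul_sum (a := t)]
  refine mul_le_mul_of_nonneg_left (Finset.sum_le_sum fun l _ => ?_) (leverageScore_nonneg hc' i)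
  by_cases hl : A l = 0
  · simp [hl]
  · rw [← mul_assoc]
    exact mul_le_mul_of_nonneg_right (h l hl) (sq_nonneg _)

end LeverageScores

section LewisWeights

variable {m n : Type*} [Fintype m] [Fintype n] [DecidableEq m] {p : ℝ} {A : Matrix m n ℝ}

theorem leverageScore_rpow_le {u v : m → ℝ} (hp : 0 < p) (hp2 : p ≤ 2)
    (hu : ∀ l, A l ≠ 0 → 0 < u l) (hv : ∀ l, A l ≠ 0 → 0 < v l) {t : ℝ} (ht : 0 < t)
    (h : ∀ l, A l ≠ 0 → u l ≤ t * v l) (i : m) :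
    leverageScore A (fun l => u l ^ (1 - 2 / p)) i ≤
      t ^ (2 / p - 1) * leverageScore A (fun l => v l ^ (1 - 2 / p)) i := by
  refine leverageScore_le_mul (fun l hl => Real.rpow_pos_of_pos (hu l hl) _)
    (fun l hl => Real.rpow_pos_of_pos (hv l hl) _) (Real.rpow_nonneg ht.le _) (fun l hl => ?_) i
  have h1 : (t * v l) ^ (1 - 2 / p) ≤ u l ^ (1 - 2 / p) :=
    Real.rpow_le_rpow_of_nonpos (hu l hl) (h l hl) (by
      rw [sub_nonpos, le_div_iff₀ hp]; linarith)
  calc v l ^ (1 - 2 / p) = t ^ (2 / p - 1) * (t * v l) ^ (1 - 2 / p) := by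
        rw [Real.mul_rpow ht.le (hv l hl).le, ← mul_assoc, ← Real.rpow_add ht]
        simp
    _ ≤ _ := mul_le_mul_of_nonneg_left h1 (Real.rpow_nonneg ht.le _)

theorem isLewisWeights_iff {w : m → ℝ} : IsLewisWeights p A w ↔
    (∀ i, A i ≠ 0 → 0 < w i) ∧
      ∀ i, w i = leverageScore A (fun l => w l ^ (1 - 2 / p)) i ^ (p / 2) := Iff.rfl

theorem exists_isLewisWeights (hp : 0 < p) (hp2 : p ≤ 2) (A : Matrix m n ℝ) :
    ∃ w, IsLewisWeights p A w := by
  classical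
  let c : (m → ℝ) → m → ℝ := fun y l => Real.exp (y l) ^ (1 - 2 / p)
  have hc : ∀ y l, A l ≠ 0 → 0 < c y l := fun y l _ => Real.rpow_pos_of_pos (Real.exp_pos _) _
  let f : (m → ℝ) → m → ℝ := fun y i =>
    if A i = 0 then 0 else p / 2 * Real.log (leverageScore A (c y) i)
  have key : ∀ y z i, f y i - f z i ≤ (1 - p / 2) * dist y z := by
    intro y z i
    have hn : 0 ≤ (1 - p / 2) * dist y z := mul_nonneg (by linarith) dist_nonneg
    by_cases hi : A i = 0
    · simpa [f, hi] using hn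
    simp only [f, hi, if_false]
    have h1 := leverageScore_rpow_le hp hp2 (A := A) (u := fun l => Real.exp (y l))
      (v := fun l => Real.exp (z l)) (fun l _ => Real.exp_pos _) (fun l _ => Real.exp_pos _)
      (Real.exp_pos (dist y z)) (fun l _ => by
        rw [← Real.exp_add]
        refine Real.exp_le_exp.2 ?_
        have := (le_abs_self _).trans (dist_le_pi_dist y z l)
        linarith) i
    have h2 := Real.log_le_log (leverageScore_pos (hc y) hi) h1
    rw [Real.log_mul (by positivity) (leverageScore_pos (hc z) hi).ne', Real.log_rpow
      (Real.exp_pos _), Real.log_exp] at h2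
    have h3 := mul_le_mul_of_nonneg_left h2 (by positivity : 0 ≤ p / 2)
    have h4 : p / 2 * ((2 / p - 1) * dist y z) = (1 - p / 2) * dist y z := by
      field_simp
    change p / 2 * Real.log (leverageScore A (c y) i)
      ≤ p / 2 * (_ + Real.log (leverageScore A (c z) i)) at h3
    rw [mul_add, h4] at h3
    linarith
  have hcontr : ContractingWith (Real.toNNReal (1 - p / 2)) f := by
    constructor
    · rw [← NNReal.coe_lt_coe, Real.coe_toNNReal _ (by linarith)]
      simp only [NNReal.coe_one]
      linarith
    · refine LipschitzWith.of_dist_le_mul fun y z => ?_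
      rw [Real.coe_toNNReal _ (by linarith)]
      refine (dist_pi_le_iff (mul_nonneg (by linarith) dist_nonneg)).2 fun i => ?_
      rw [Real.dist_eq, abs_le]
      have h1 := key y z i
      have h2 := key z y i
      rw [dist_comm] at h2
      exact ⟨by linarith, h1⟩
  let y := hcontr.fixedPoint
  have hy : f y = y := hcontr.fixedPoint_isFixedPt
  refine ⟨fun i => if A i = 0 then 0 else Real.exp (y i), isLewisWeights_iff.2 ⟨fun i hi => ?_,
    fun i => ?_⟩⟩
  · simp only [hi, if_false]
    exact Real.exp_pos _
  · rw [leverageScore_congr (c' := c y) fun l hl => by simp [c, hl]]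
    by_cases hi : A i = 0
    · simp [hi, leverageScore, Real.zero_rpow (by positivity : p / 2 ≠ 0)]
    · have h1 := congrFun hy i
      simp only [f, hi, if_false] at h1 ⊢
      rw [← h1, mul_comm, Real.exp_mul, Real.exp_log (leverageScore_pos (hc y) hi)]

theorem isLewisWeights_lewisWeights (hp : 0 < p) (hp2 : p ≤ 2) (A : Matrix m n ℝ) :
    IsLewisWeights p A (lewisWeights p A) :=
  Classical.epsilon_spec (exists_isLewisWeights hp hp2 A)

theorem IsLewisWeights.eq_zero {w : m → ℝ} (hw : IsLewisWeights p A w) (hp : 0 < p) {i : m}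
    (hi : A i = 0) : w i = 0 := by
  rw [(isLewisWeights_iff.1 hw).2 i]
  simp [leverageScore, hi, Real.zero_rpow (by positivity : p / 2 ≠ 0)]

theorem IsLewisWeights.nonneg {w : m → ℝ} (hw : IsLewisWeights p A w) (hp : 0 < p) (i : m) :
    0 ≤ w i := by
  by_cases hi : A i = 0
  · exact (hw.eq_zero hp hi).ge
  · exact (hw.1 i hi).le

theorem IsLewisWeights.rpow_eq {w : m → ℝ} (hw : IsLewisWeights p A w) (hp : 0 < p) (i : m) :
    w i ^ (2 / p) = leverageScore A (fun l => w l ^ (1 - 2 / p)) i := by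
  conv_lhs => rw [(isLewisWeights_iff.1 hw).2 i]
  rw [← Real.rpow_mul (leverageScore_nonneg
    (fun l hl => Real.rpow_pos_of_pos (hw.1 l hl) _) i)]
  rw [show p / 2 * (2 / p) = 1 by field_simp, Real.rpow_one]

theorem le_mul_of_ratio {u v : m → ℝ} {s K : ℝ}
    (hu : ∀ l, A l ≠ 0 → 0 < u l) (hv : ∀ l, A l ≠ 0 → 0 < v l)
    (h : ∀ t, 0 < t → (∀ l, A l ≠ 0 → u l ≤ t * v l) →
      ∀ i, A i ≠ 0 → u i ^ s ≤ K * t ^ (s - 1) * v i ^ s)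
    {i : m} (hi : A i ≠ 0) : u i ≤ K * v i := by
  classical
  obtain ⟨j, hj, hmax⟩ := (Finset.univ.filter fun l => A l ≠ 0).exists_max_image
    (fun l => u l / v l) ⟨i, by simpa using hi⟩
  simp only [Finset.mem_filter, Finset.mem_univ, true_and] at hj hmax
  have ht : 0 < u j / v j := div_pos (hu j hj) (hv j hj)
  set t := u j / v j with htd
  have h1 := h t ht (fun l hl => (div_le_iff₀ (hv l hl)).1 (hmax l hl)) j hj
  rw [show u j = t * v j by rw [htd, div_mul_cancel₀ _ (hv j hj).ne'],
    Real.mul_rpow ht.le (hv j hj).le] at h1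
  have h2 := le_of_mul_le_mul_right h1 (Real.rpow_pos_of_pos (hv j hj) s)
  rw [Real.rpow_sub ht, Real.rpow_one, mul_div_assoc', le_div_iff₀ ht, mul_comm] at h2
  have h3 := le_of_mul_le_mul_right h2 (Real.rpow_pos_of_pos ht s)
  exact ((div_le_iff₀ (hv i hi)).1 (hmax i hi)).trans
    (mul_le_mul_of_nonneg_right h3 (hv i hi).le)

theorem IsLewisWeights.le_mul_of_rpow_le {w u : m → ℝ} (hw : IsLewisWeights p A w) (hp : 0 < p)
    (hp2 : p ≤ 2) (hu : ∀ l, A l ≠ 0 → 0 < u l) {K : ℝ} (hK : 0 < K)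
    (h : ∀ i, A i ≠ 0 → u i ^ (2 / p) ≤ K * leverageScore A (fun l => u l ^ (1 - 2 / p)) i)
    {i : m} (hi : A i ≠ 0) : u i ≤ K * w i := by
  refine le_mul_of_ratio (s := 2 / p) hu hw.1 (fun t ht hle j hj => ?_) hi
  refine (h j hj).trans ?_
  rw [mul_assoc, hw.rpow_eq hp]
  exact mul_le_mul_of_nonneg_left (leverageScore_rpow_le hp hp2 hu hw.1 ht hle j) hK.le

theorem IsLewisWeights.le_mul_of_le_rpow {w u : m → ℝ} (hw : IsLewisWeights p A w) (hp : 0 < p)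
    (hp2 : p ≤ 2) (hu : ∀ l, A l ≠ 0 → 0 < u l) {K : ℝ}
    (h : ∀ i, A i ≠ 0 → leverageScore A (fun l => u l ^ (1 - 2 / p)) i ≤ K * u i ^ (2 / p))
    {i : m} (hi : A i ≠ 0) : w i ≤ K * u i := by
  refine le_mul_of_ratio (s := 2 / p) hw.1 hu (fun t ht hle j hj => ?_) hi
  rw [hw.rpow_eq hp, mul_comm K, mul_assoc]
  exact (leverageScore_rpow_le hp hp2 hw.1 hu ht hle j).trans
    (mul_le_mul_of_nonneg_left (h j hj) (Real.rpow_nonneg ht.le _))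

/-- Adding rows decreases the Lewis weights. -/
theorem IsLewisWeights.apply_le_of_submatrix {m' : Type*} [Fintype m'] [DecidableEq m']
    {e : m' → m} (he : Function.Injective e) {w : m → ℝ} {w' : m' → ℝ} (hp : 0 < p) (hp2 : p ≤ 2)
    (hw : IsLewisWeights p A w) (hw' : IsLewisWeights p (A.submatrix e id) w') (i : m') :
    w (e i) ≤ w' i := by
  have hrow : ∀ l, A.submatrix e id l = A (e l) := fun l => rfl
  by_cases hi : A (e i) = 0
  · rw [hw.eq_zero hp hi]
    exact hw'.nonneg hp i
  have hu : ∀ l, A.submatrix e id l ≠ 0 → 0 < w (e l) := fun l hl => hw.1 _ hl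
  have hc : ∀ l, A l ≠ 0 → 0 < w l ^ (1 - 2 / p) :=
    fun l hl => Real.rpow_pos_of_pos (hw.1 l hl) _
  have hc' : ∀ l, A.submatrix e id l ≠ 0 → 0 < w (e l) ^ (1 - 2 / p) := fun l hl => hc _ hl
  rw [← one_mul (w' i)]
  refine hw'.le_mul_of_rpow_le (u := fun l => w (e l)) hp hp2 hu one_pos (fun j hj => ?_) hi
  rw [one_mul, hw.rpow_eq hp]
  refine leverageScore_le hc (leverageScore_nonneg hc' j) fun x => ?_
  refine (sq_dotProduct_le_leverageScore_mul hc' j x).trans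
    (mul_le_mul_of_nonneg_left ?_ (leverageScore_nonneg hc' j))
  simp only [hrow]
  rw [← Finset.sum_image (f := fun l => w l ^ (1 - 2 / p) * (A l ⬝ᵥ x) ^ 2)
    (fun a _ b _ h => he h)]
  exact Finset.sum_le_univ_sum_of_nonneg fun l => weighted_sq_nonneg hc x l

end LewisWeights

section TraceInequalities

theorem pow_mul_pow_add_le {x y : ℝ} (hx : 0 ≤ x) (hy : 0 ≤ y) (i j : ℕ) :
    x ^ i * y ^ j + x ^ j * y ^ i ≤ x ^ (i + j) + y ^ (i + j) := by
  have : 0 ≤ (x ^ i - y ^ i) * (x ^ j - y ^ j) := by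
    rcases le_total x y with h | h
    · exact mul_nonneg_of_nonpos_of_nonpos (sub_nonpos.2 (pow_le_pow_left₀ hx h i))
        (sub_nonpos.2 (pow_le_pow_left₀ hx h j))
    · exact mul_nonneg (sub_nonneg.2 (pow_le_pow_left₀ hy h i))
        (sub_nonneg.2 (pow_le_pow_left₀ hy h j))
  rw [pow_add, pow_add]
  linarith

theorem sub_mul_pow_sub_pow_le (a b : ℝ) (k : ℕ) :
    (a - b) * (a ^ (2 * k + 1) - b ^ (2 * k + 1)) ≤
      (2 * k + 1) / 2 * ((a - b) ^ 2 * (a ^ (2 * k) + b ^ (2 * k))) := by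
  have h1 := geom_sum₂_mul a b (2 * k + 1)
  have h2 : 2 * ∑ i ∈ Finset.range (2 * k + 1), a ^ i * b ^ (2 * k + 1 - 1 - i) ≤
      (2 * k + 1) * (a ^ (2 * k) + b ^ (2 * k)) := by
    have h3 := Finset.sum_range_reflect (fun i => a ^ i * b ^ (2 * k + 1 - 1 - i)) (2 * k + 1)
    rw [two_mul]
    nth_rw 1 [← h3]
    rw [← Finset.sum_add_distrib]
    have h4 : ∀ i ∈ Finset.range (2 * k + 1),
        a ^ (2 * k + 1 - 1 - i) * b ^ (2 * k + 1 - 1 - (2 * k + 1 - 1 - i)) +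
          a ^ i * b ^ (2 * k + 1 - 1 - i) ≤ a ^ (2 * k) + b ^ (2 * k) := by
      intro i hi
      have hi' := Finset.mem_range.1 hi
      rw [show 2 * k + 1 - 1 - (2 * k + 1 - 1 - i) = i by omega]
      set j := 2 * k + 1 - 1 - i with hj
      have hij : j + i = 2 * k := by omega
      have h5 := pow_mul_pow_add_le (abs_nonneg a) (abs_nonneg b) j i
      rw [hij, (even_two_mul k).pow_abs, (even_two_mul k).pow_abs] at h5
      refine le_trans (add_le_add ?_ ?_) h5
      · rw [← abs_pow, ← abs_pow, ← abs_mul]; exact le_abs_self _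
      · rw [← abs_pow, ← abs_pow, ← abs_mul]; exact le_abs_self _
    refine (Finset.sum_le_sum h4).trans (le_of_eq ?_)
    simp
    ring
  rw [← h1]
  nlinarith [sq_nonneg (a - b)]

variable {n : Type*} [Fintype n] [DecidableEq n]

theorem exists_spectral_decomposition {A : Matrix n n ℝ} (hA : Aᵀ = A) :
    ∃ (U : Matrix n n ℝ) (a : n → ℝ), Uᵀ * U = 1 ∧ U * Uᵀ = 1 ∧
      ∀ k : ℕ, A ^ k = U * diagonal (fun i => a i ^ k) * Uᵀ := by
  have hH : A.IsHermitian := by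
    rw [Matrix.IsHermitian, conjTranspose_eq_transpose_of_trivial, hA]
  have hU : (hH.eigenvectorUnitary : Matrix n n ℝ)ᵀ * hH.eigenvectorUnitary = 1 := by
    have := Unitary.coe_star_mul_self hH.eigenvectorUnitary
    rwa [star_eq_conjTranspose, conjTranspose_eq_transpose_of_trivial] at this
  have hA' : A = hH.eigenvectorUnitary * diagonal hH.eigenvalues *
      (hH.eigenvectorUnitary : Matrix n n ℝ)ᵀ := by
    have := hH.spectral_theorem
    rw [Unitary.conjStarAlgAut_apply, star_eq_conjTranspose,
      conjTranspose_eq_transpose_of_trivial] at this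
    exact this
  generalize (hH.eigenvectorUnitary : Matrix n n ℝ) = U at hU hA'
  generalize hH.eigenvalues = a at hA'
  have hU' := mul_eq_one_comm.1 hU
  refine ⟨U, a, hU, hU', fun k => ?_⟩
  induction k with
  | zero => simp [hU']
  | succ k ih =>
    rw [pow_succ, ih]
    calc U * diagonal (fun i => a i ^ k) * Uᵀ * A
        = U * diagonal (fun i => a i ^ k) * Uᵀ * (U * diagonal a * Uᵀ) := by rw [← hA']
      _ = U * diagonal (fun i => a i ^ k) * (Uᵀ * U) * diagonal a * Uᵀ := by
        simp only [Matrix.mul_assoc]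
      _ = U * diagonal (fun i => a i ^ (k + 1)) * Uᵀ := by
        rw [hU, Matrix.mul_one, Matrix.mul_assoc U, diagonal_mul_diagonal]
        simp only [pow_succ]

theorem exists_trace_pow_mul_pow {A B : Matrix n n ℝ} (hA : Aᵀ = A) (hB : Bᵀ = B) :
    ∃ (a b : n → ℝ) (O : n → n → ℝ), (∀ i j, 0 ≤ O i j) ∧
      ∀ k l : ℕ, trace (A ^ k * B ^ l) = ∑ i, ∑ j, a i ^ k * b j ^ l * O i j := by
  obtain ⟨U, a, -, -, hUa⟩ := exists_spectral_decomposition hA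
  obtain ⟨V, b, -, -, hVb⟩ := exists_spectral_decomposition hB
  refine ⟨a, b, fun i j => (Uᵀ * V) i j ^ 2, fun i j => sq_nonneg _, fun k l => ?_⟩
  have h : trace (A ^ k * B ^ l) = trace ((diagonal (fun i => a i ^ k) * (Uᵀ * V)) *
      (diagonal (fun i => b i ^ l) * (Uᵀ * V)ᵀ)) := by
    rw [hUa, hVb, Matrix.mul_assoc U, Matrix.mul_assoc U, trace_mul_comm U]
    simp only [Matrix.mul_assoc, transpose_mul, transpose_transpose]
  rw [h, trace]
  refine Finset.sum_congr rfl fun i _ => ?_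
  rw [diag_apply, Matrix.mul_apply]
  refine Finset.sum_congr rfl fun j _ => ?_
  rw [diagonal_mul, diagonal_mul, transpose_apply]
  ring

/-- The mean value trace inequality for odd powers. -/
theorem trace_sub_mul_pow_sub_pow_le {A B : Matrix n n ℝ} (hA : Aᵀ = A) (hB : Bᵀ = B) (k : ℕ) :
    trace ((A - B) * (A ^ (2 * k + 1) - B ^ (2 * k + 1))) ≤
      (2 * k + 1) / 2 * trace ((A - B) * (A - B) * (A ^ (2 * k) + B ^ (2 * k))) := by
  obtain ⟨a, b, O, hO, h⟩ := exists_trace_pow_mul_pow hA hB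
  have e1 : trace ((A - B) * (A ^ (2 * k + 1) - B ^ (2 * k + 1))) =
      trace (A ^ (2 * k + 2) * B ^ 0) - trace (A ^ 1 * B ^ (2 * k + 1)) -
        trace (A ^ (2 * k + 1) * B ^ 1) + trace (A ^ 0 * B ^ (2 * k + 2)) := by
    rw [sub_mul, mul_sub, mul_sub, trace_sub, trace_sub, trace_sub, trace_mul_comm B (A ^ _)]
    simp only [pow_zero, Matrix.mul_one, Matrix.one_mul, pow_one, ← pow_succ']
    ring
  have e2 : trace ((A - B) * (A - B) * (A ^ (2 * k) + B ^ (2 * k))) =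
      trace (A ^ (2 * k + 2) * B ^ 0) + trace (A ^ 2 * B ^ (2 * k))
        - 2 * trace (A ^ (2 * k + 1) * B ^ 1) - 2 * trace (A ^ 1 * B ^ (2 * k + 1))
        + trace (A ^ (2 * k) * B ^ 2) + trace (A ^ 0 * B ^ (2 * k + 2)) := by
    have f1 : trace (A * B * A ^ (2 * k)) = trace (A ^ (2 * k + 1) * B ^ 1) := by
      rw [trace_mul_comm, ← Matrix.mul_assoc, ← pow_succ, pow_one]
    have f2 : trace (B * A * A ^ (2 * k)) = trace (A ^ (2 * k + 1) * B ^ 1) := by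
      rw [Matrix.mul_assoc, trace_mul_comm, ← pow_succ', pow_one]
    have f3 : trace (B * B * A ^ (2 * k)) = trace (A ^ (2 * k) * B ^ 2) := by
      rw [trace_mul_comm, pow_two]
    have f4 : trace (B * A * B ^ (2 * k)) = trace (A ^ 1 * B ^ (2 * k + 1)) := by
      rw [Matrix.mul_assoc, trace_mul_comm, Matrix.mul_assoc, ← pow_succ, pow_one]
    have f5 : A * A * A ^ (2 * k) = A ^ (2 * k + 2) := by rw [← pow_two, ← pow_add, add_comm]
    have f6 : B * B * B ^ (2 * k) = B ^ (2 * k + 2) := by rw [← pow_two, ← pow_add, add_comm]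
    have f7 : trace (A * B * B ^ (2 * k)) = trace (A ^ 1 * B ^ (2 * k + 1)) := by
      rw [Matrix.mul_assoc, ← pow_succ', pow_one]
    simp only [sub_mul, mul_sub, mul_add, trace_sub, trace_add, f1, f2, f3, f4, f5, f6, f7]
    simp only [pow_zero, Matrix.mul_one, Matrix.one_mul, pow_two]
    ring
  rw [e1, e2]
  simp only [h]
  simp only [Finset.mul_sum, ← Finset.sum_add_distrib, ← Finset.sum_sub_distrib]
  refine Finset.sum_le_sum fun i _ => Finset.sum_le_sum fun j _ => ?_
  have := mul_le_mul_of_nonneg_right (sub_mul_pow_sub_pow_le (a i) (b j) k) (hO i j)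
  refine le_trans (le_of_eq ?_) (this.trans (le_of_eq ?_)) <;> ring

theorem trace_vecMulVec_mul (v : n → ℝ) (N : Matrix n n ℝ) :
    trace (vecMulVec v v * N) = v ⬝ᵥ (N *ᵥ v) := by
  rw [vecMulVec_mul, trace_vecMulVec, dotProduct_mulVec, dotProduct_comm]

theorem dotProduct_pow_sub_le {A B : Matrix n n ℝ} (hA : Aᵀ = A) (hB : Bᵀ = B) {v : n → ℝ}
    {t : ℝ} (ht : 0 < t) (h : A - B = t • vecMulVec v v) (k : ℕ) :
    v ⬝ᵥ (A ^ (2 * k + 1) *ᵥ v) - v ⬝ᵥ (B ^ (2 * k + 1) *ᵥ v) ≤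
      (2 * k + 1) / 2 * (t * (v ⬝ᵥ v)) *
        (v ⬝ᵥ (A ^ (2 * k) *ᵥ v) + v ⬝ᵥ (B ^ (2 * k) *ᵥ v)) := by
  have h1 := trace_sub_mul_pow_sub_pow_le hA hB k
  have h2 : vecMulVec v v * vecMulVec v v = (v ⬝ᵥ v) • vecMulVec v v := by
    rw [vecMulVec_mul_vecMulVec, vecMulVec_smul]
  rw [h, smul_mul_smul_comm, h2, smul_smul, smul_mul_assoc, smul_mul_assoc, trace_smul, trace_smul,
    trace_vecMulVec_mul, trace_vecMulVec_mul, sub_mulVec, add_mulVec, dotProduct_sub,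
    dotProduct_add, smul_eq_mul, smul_eq_mul] at h1
  refine le_of_mul_le_mul_left (h1.trans (le_of_eq ?_)) ht
  ring

theorem trace_pow_succ_le {A : Matrix n n ℝ} (hA : Aᵀ = A) (k : ℕ) :
    2 * trace (A ^ (2 * k + 1)) ≤ trace (A ^ (2 * k)) + trace (A ^ (2 * k + 2)) := by
  obtain ⟨a, b, O, hO, h⟩ := exists_trace_pow_mul_pow hA hA
  have h' : ∀ l : ℕ, trace (A ^ l) = ∑ i, ∑ j, a i ^ l * O i j := fun l => by
    have := h l 0
    simpa using this
  simp only [h', Finset.mul_sum, ← Finset.sum_add_distrib]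
  refine Finset.sum_le_sum fun i _ => Finset.sum_le_sum fun j _ => ?_
  have h1 : 0 ≤ (a i ^ k) ^ 2 * (a i - 1) ^ 2 * O i j :=
    mul_nonneg (mul_nonneg (sq_nonneg _) (sq_nonneg _)) (hO i j)
  have h2 : (a i ^ k) ^ 2 * (a i - 1) ^ 2 * O i j =
      a i ^ (2 * k) * O i j + a i ^ (2 * k + 2) * O i j - 2 * (a i ^ (2 * k + 1) * O i j) := by
    ring
  linarith

theorem trace_pow_two_mul_nonneg {A : Matrix n n ℝ} (hA : Aᵀ = A) (k : ℕ) :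
    0 ≤ trace (A ^ (2 * k)) := by
  obtain ⟨a, b, O, hO, h⟩ := exists_trace_pow_mul_pow hA hA
  have := h (2 * k) 0
  rw [pow_zero, Matrix.mul_one] at this
  rw [this]
  exact Finset.sum_nonneg fun i _ => Finset.sum_nonneg fun j _ =>
    mul_nonneg (by rw [pow_zero, mul_one, pow_mul]; positivity) (hO i j)

theorem dotProduct_pow_two_mul {A : Matrix n n ℝ} (hA : Aᵀ = A) (k : ℕ) (v : n → ℝ) :
    v ⬝ᵥ (A ^ (2 * k) *ᵥ v) = (A ^ k *ᵥ v) ⬝ᵥ (A ^ k *ᵥ v) := by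
  rw [two_mul, pow_add, ← mulVec_mulVec, dotProduct_mulVec, ← mulVec_transpose, transpose_pow, hA]

theorem dotProduct_pow_two_mul_nonneg {A : Matrix n n ℝ} (hA : Aᵀ = A) (k : ℕ) (v : n → ℝ) :
    0 ≤ v ⬝ᵥ (A ^ (2 * k) *ᵥ v) := by
  rw [dotProduct_pow_two_mul hA]
  exact Finset.sum_nonneg fun i _ => mul_self_nonneg _

theorem abs_dotProduct_mulVec_le_of_trace_pow_le {A : Matrix n n ℝ} (hA : Aᵀ = A) {k : ℕ}
    (hk : k ≠ 0) {ε : ℝ} (hε : 0 ≤ ε) (h : trace (A ^ (2 * k)) ≤ ε ^ (2 * k)) (y : n → ℝ) :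
    |y ⬝ᵥ (A *ᵥ y)| ≤ ε * (y ⬝ᵥ y) := by
  obtain ⟨U, a, hU, hU', hUa⟩ := exists_spectral_decomposition hA
  have ha : ∀ i, |a i| ≤ ε := by
    intro i
    rw [hUa, trace_mul_comm, ← Matrix.mul_assoc, hU, Matrix.one_mul, trace_diagonal] at h
    have h1 : a i ^ (2 * k) ≤ ∑ i, a i ^ (2 * k) :=
      Finset.single_le_sum (f := fun i => a i ^ (2 * k))
        (fun i _ => (even_two_mul k).pow_nonneg _) (Finset.mem_univ i)
    rw [← (even_two_mul k).pow_abs] at h1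
    exact le_of_pow_le_pow_left₀ (by omega) hε (h1.trans h)
  have h1 : y ⬝ᵥ (A *ᵥ y) = ∑ i, a i * (Uᵀ *ᵥ y) i ^ 2 := by
    have := hUa 1
    rw [pow_one] at this
    rw [this, ← mulVec_mulVec, ← mulVec_mulVec, dotProduct_mulVec, ← mulVec_transpose, dotProduct]
    refine Finset.sum_congr rfl fun i _ => ?_
    rw [mulVec_diagonal]
    ring
  have h2 : y ⬝ᵥ y = ∑ i, (Uᵀ *ᵥ y) i ^ 2 := by
    have h3 : (Uᵀ *ᵥ y) ⬝ᵥ (Uᵀ *ᵥ y) = y ⬝ᵥ y := by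
      rw [dotProduct_mulVec, vecMul_transpose, mulVec_mulVec, hU', one_mulVec]
    rw [← h3, dotProduct]
    exact Finset.sum_congr rfl fun i _ => (sq _).symm
  rw [h1, h2, Finset.mul_sum]
  refine (Finset.abs_sum_le_sum_abs _ _).trans (Finset.sum_le_sum fun i _ => ?_)
  rw [abs_mul, abs_of_nonneg (sq_nonneg ((Uᵀ *ᵥ y) i))]
  exact mul_le_mul_of_nonneg_right (ha i) (sq_nonneg _)

end TraceInequalities

section BernoulliSampling

variable {ι n : Type*} [Fintype ι] [DecidableEq ι] [Fintype n] [DecidableEq n]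

/-- The probability that exactly the indices in `S` are sampled. -/
noncomputable def samplingWeight (q : ι → ℝ) (S : Finset ι) : ℝ :=
  ∏ i, if i ∈ S then q i else 1 - q i

theorem samplingWeight_nonneg {q : ι → ℝ} (hq : ∀ i, 0 ≤ q i ∧ q i ≤ 1) (S : Finset ι) :
    0 ≤ samplingWeight q S :=
  Finset.prod_nonneg fun i _ => by
    split_ifs
    · exact (hq i).1
    · exact sub_nonneg.2 (hq i).2

theorem sum_samplingWeight (q : ι → ℝ) : ∑ S, samplingWeight q S = 1 := by
  have h := Finset.prod_add q (fun i => 1 - q i) Finset.univ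
  simp only [add_sub_cancel, Finset.prod_const_one, Finset.powerset_univ] at h
  rw [h]
  refine Finset.sum_congr rfl fun S _ => ?_
  rw [samplingWeight, Finset.prod_ite]
  congr 2 <;> ext i <;> simp

/-- Resampling the index `j` does not change expectations. -/
theorem sum_samplingWeight_mul_eq (q : ι → ℝ) (j : ι) (F : Finset ι → ℝ) :
    ∑ S, samplingWeight q S * F S =
      ∑ S, samplingWeight q S * (q j * F (insert j S) + (1 - q j) * F (S.erase j)) := by
  have hu : (Finset.univ : Finset (Finset ι)) = (insert j (Finset.univ.erase j)).powerset := by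
    rw [Finset.insert_erase (Finset.mem_univ j), Finset.powerset_univ]
  rw [hu, Finset.sum_powerset_insert (Finset.notMem_erase j _),
    Finset.sum_powerset_insert (Finset.notMem_erase j _), ← Finset.sum_add_distrib,
    ← Finset.sum_add_distrib]
  refine Finset.sum_congr rfl fun S hS => ?_
  have hj : j ∉ S := fun h => Finset.notMem_erase j _ (Finset.mem_powerset.1 hS h)
  have h1 : samplingWeight q S =
      (1 - q j) * ∏ i ∈ Finset.univ.erase j, if i ∈ S then q i else 1 - q i := by
    rw [samplingWeight, ← Finset.mul_prod_erase _ _ (Finset.mem_univ j), if_neg hj]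
  have h2 : samplingWeight q (insert j S) =
      q j * ∏ i ∈ Finset.univ.erase j, if i ∈ S then q i else 1 - q i := by
    rw [samplingWeight, ← Finset.mul_prod_erase _ _ (Finset.mem_univ j),
      if_pos (Finset.mem_insert_self j S)]
    congr 1
    refine Finset.prod_congr rfl fun i hi => ?_
    simp [Finset.mem_insert, Finset.ne_of_mem_erase hi]
  rw [Finset.insert_idem, Finset.erase_insert hj, Finset.erase_eq_of_notMem hj, h1, h2]
  ring

/-- The relative error `ξ / q - 1` of the importance sampling estimator at an index, where `ξ`
is the indicator of the event that the index is sampled. -/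
noncomputable def samplingError (q : ι → ℝ) (S : Finset ι) (j : ι) : ℝ :=
  (if j ∈ S then (q j)⁻¹ else 0) - 1

/-- The deviation of the sampled sum of rank-one matrices from its mean. -/
noncomputable def samplingDeviation (q : ι → ℝ) (v : ι → n → ℝ) (S : Finset ι) : Matrix n n ℝ :=
  ∑ j, samplingError q S j • vecMulVec (v j) (v j)

theorem samplingDeviation_transpose (q : ι → ℝ) (v : ι → n → ℝ) (S : Finset ι) :
    (samplingDeviation q v S)ᵀ = samplingDeviation q v S := by
  simp [samplingDeviation, transpose_sum, transpose_vecMulVec]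

theorem trace_samplingDeviation_mul (q : ι → ℝ) (v : ι → n → ℝ) (S : Finset ι)
    (N : Matrix n n ℝ) :
    trace (samplingDeviation q v S * N) = ∑ j, samplingError q S j * (v j ⬝ᵥ (N *ᵥ v j)) := by
  rw [samplingDeviation, Finset.sum_mul, trace_sum]
  refine Finset.sum_congr rfl fun j _ => ?_
  rw [smul_mul_assoc, trace_smul, trace_vecMulVec_mul, smul_eq_mul]

theorem dotProduct_samplingDeviation_mulVec (q : ι → ℝ) (v : ι → n → ℝ) (S : Finset ι)
    (y : n → ℝ) :
    y ⬝ᵥ (samplingDeviation q v S *ᵥ y) = ∑ j, samplingError q S j * (v j ⬝ᵥ y) ^ 2 := by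
  rw [← trace_vecMulVec_mul, trace_mul_comm, trace_samplingDeviation_mul]
  refine Finset.sum_congr rfl fun j _ => ?_
  rw [vecMulVec_mulVec, op_smul_eq_smul, dotProduct_smul, smul_eq_mul, dotProduct_comm y, pow_two]

theorem samplingDeviation_insert_sub_erase (q : ι → ℝ) (v : ι → n → ℝ) (S : Finset ι) (j : ι) :
    samplingDeviation q v (insert j S) - samplingDeviation q v (S.erase j) =
      (q j)⁻¹ • vecMulVec (v j) (v j) := by
  rw [samplingDeviation, samplingDeviation, ← Finset.sum_sub_distrib,
    Finset.sum_eq_single_of_mem j (Finset.mem_univ j)]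
  · rw [← sub_smul]
    simp [samplingError]
  · intro i _ hi
    simp [samplingError, Finset.mem_insert, hi]

theorem sum_dotProduct_pow_two_mul_le {v : ι → n → ℝ} (hv : ∀ y, ∑ j, (v j ⬝ᵥ y) ^ 2 ≤ y ⬝ᵥ y)
    {X : Matrix n n ℝ} (hX : Xᵀ = X) (k : ℕ) :
    ∑ j, v j ⬝ᵥ (X ^ (2 * k) *ᵥ v j) ≤ trace (X ^ (2 * k)) := by
  have h1 : trace (X ^ (2 * k)) = ∑ a, (X ^ k) a ⬝ᵥ (X ^ k) a := by
    rw [two_mul, pow_add]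
    nth_rw 2 [← hX]
    rw [← transpose_pow]
    rfl
  rw [h1]
  calc ∑ j, v j ⬝ᵥ (X ^ (2 * k) *ᵥ v j) = ∑ j, ∑ a, (v j ⬝ᵥ (X ^ k) a) ^ 2 := by
        refine Finset.sum_congr rfl fun j _ => ?_
        rw [dotProduct_pow_two_mul hX]
        refine Finset.sum_congr rfl fun a _ => ?_
        rw [pow_two, dotProduct_comm (v j)]
        rfl
    _ = ∑ a, ∑ j, (v j ⬝ᵥ (X ^ k) a) ^ 2 := Finset.sum_comm
    _ ≤ _ := Finset.sum_le_sum fun a _ => hv _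

theorem sum_samplingWeight_mul_samplingError_le {q : ι → ℝ} (hq : ∀ i, 0 ≤ q i ∧ q i ≤ 1)
    {v : ι → n → ℝ} {β : ℝ} (hβ : 0 < β) (j : ι) (hj : q j = 1 ∨ β * (v j ⬝ᵥ v j) ≤ q j) (k : ℕ) :
    ∑ S, samplingWeight q S * (samplingError q S j *
        (v j ⬝ᵥ (samplingDeviation q v S ^ (2 * k + 1) *ᵥ v j))) ≤
      (2 * k + 1) / (2 * β) * ∑ S, samplingWeight q S * ((samplingError q S j + 2) *
        (v j ⬝ᵥ (samplingDeviation q v S ^ (2 * k) *ᵥ v j))) := by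
  have hg : ∀ S, 0 ≤ v j ⬝ᵥ (samplingDeviation q v S ^ (2 * k) *ᵥ v j) := fun S =>
    dotProduct_pow_two_mul_nonneg (samplingDeviation_transpose q v S) k _
  have hvv : 0 ≤ v j ⬝ᵥ v j := Finset.sum_nonneg fun i _ => mul_self_nonneg _
  rcases (hq j).1.eq_or_lt with h0 | h0
  · have hv0 : v j = 0 := by
      rcases hj with hj | hj
      · linarith
      · rw [← h0] at hj
        exact dotProduct_self_eq_zero.1 (le_antisymm (by nlinarith) hvv)
    simp [hv0]
  have hr := sum_samplingWeight_mul_eq q j fun S => (samplingError q S j + 2) *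
    (v j ⬝ᵥ (samplingDeviation q v S ^ (2 * k) *ᵥ v j))
  rw [hr, sum_samplingWeight_mul_eq q j, Finset.mul_sum]
  refine Finset.sum_le_sum fun S _ => ?_
  rw [mul_left_comm ((2 * (k : ℝ) + 1) / (2 * β))]
  refine mul_le_mul_of_nonneg_left ?_ (samplingWeight_nonneg hq S)
  have e1 : samplingError q (insert j S) j = (q j)⁻¹ - 1 := by simp [samplingError]
  have e2 : samplingError q (S.erase j) j = -1 := by simp [samplingError]
  have hd := dotProduct_pow_sub_le (samplingDeviation_transpose q v (insert j S))
    (samplingDeviation_transpose q v (S.erase j)) (inv_pos.2 h0)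
    (samplingDeviation_insert_sub_erase q v S j) k
  have hg1 := hg (insert j S)
  have hg2 := hg (S.erase j)
  rw [e1, e2]
  set x := v j ⬝ᵥ (samplingDeviation q v (insert j S) ^ (2 * k) *ᵥ v j)
  set y := v j ⬝ᵥ (samplingDeviation q v (S.erase j) ^ (2 * k) *ᵥ v j)
  set x' := v j ⬝ᵥ (samplingDeviation q v (insert j S) ^ (2 * k + 1) *ᵥ v j)
  set y' := v j ⬝ᵥ (samplingDeviation q v (S.erase j) ^ (2 * k + 1) *ᵥ v j)
  have hq1 : 0 ≤ 1 - q j := sub_nonneg.2 (hq j).2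
  have hqi : q j * (q j)⁻¹ = 1 := mul_inv_cancel₀ h0.ne'
  have l1 : q j * (((q j)⁻¹ - 1) * x') + (1 - q j) * (-1 * y') = (1 - q j) * (x' - y') := by
    linear_combination x' * hqi
  have l2 : q j * (((q j)⁻¹ - 1 + 2) * x) + (1 - q j) * ((-1 + 2) * y) =
      (1 + q j) * x + (1 - q j) * y := by
    linear_combination x * hqi
  rw [l1, l2]
  have hc : (0 : ℝ) ≤ (2 * k + 1) / (2 * β) := by positivity
  calc (1 - q j) * (x' - y') ≤ (2 * k + 1) / (2 * β) * ((1 - q j) * (x + y)) := by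
        rcases hj with hj | hj
        · simp [hj]
        · rw [mul_left_comm]
          refine mul_le_mul_of_nonneg_left (hd.trans
            (mul_le_mul_of_nonneg_right ?_ (add_nonneg hg1 hg2))) hq1
          have : (q j)⁻¹ * (v j ⬝ᵥ v j) ≤ β⁻¹ := by
            rw [inv_mul_le_iff₀ h0, ← div_eq_mul_inv, le_div_iff₀ hβ, mul_comm]
            exact hj
          calc (2 * (k : ℝ) + 1) / 2 * ((q j)⁻¹ * (v j ⬝ᵥ v j)) ≤ (2 * k + 1) / 2 * β⁻¹ :=
                mul_le_mul_of_nonneg_left this (by positivity)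
            _ = _ := by field_simp
    _ ≤ _ := mul_le_mul_of_nonneg_left (by nlinarith) hc

theorem sum_samplingWeight_mul_trace_pow_le {q : ι → ℝ} (hq : ∀ i, 0 ≤ q i ∧ q i ≤ 1)
    {v : ι → n → ℝ} (hv : ∀ y, ∑ j, (v j ⬝ᵥ y) ^ 2 ≤ y ⬝ᵥ y)
    {β : ℝ} (hj : ∀ j, q j = 1 ∨ β * (v j ⬝ᵥ v j) ≤ q j) {K : ℕ} (hK : 0 < K) (hKβ : K ≤ β) :
    ∑ S, samplingWeight q S * trace (samplingDeviation q v S ^ (2 * K)) ≤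
      (5 * K / β) ^ K * Fintype.card n := by
  have hK0 : (0 : ℝ) < K := Nat.cast_pos.2 hK
  have hβ : 0 < β := hK0.trans_le hKβ
  have key : ∀ k ≤ K, ∑ S, samplingWeight q S * trace (samplingDeviation q v S ^ (2 * k)) ≤
      (5 * K / β) ^ k * Fintype.card n := by
    intro k
    induction k with
    | zero =>
      intro _
      simp only [mul_zero, pow_zero, trace_one, one_mul]
      rw [← Finset.sum_mul, sum_samplingWeight, one_mul]
    | succ k ih =>
      intro hk
      have ih := ih (by omega)
      have hm0 : 0 ≤ ∑ S, samplingWeight q S * trace (samplingDeviation q v S ^ (2 * k)) :=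
        Finset.sum_nonneg fun S _ => mul_nonneg (samplingWeight_nonneg hq S)
          (trace_pow_two_mul_nonneg (samplingDeviation_transpose q v S) k)
      set m := ∑ S, samplingWeight q S * trace (samplingDeviation q v S ^ (2 * k))
      have h1 : ∑ S, samplingWeight q S * trace (samplingDeviation q v S ^ (2 * (k + 1))) ≤
          (2 * k + 1) / (2 * β) * ∑ S, samplingWeight q S *
            (trace (samplingDeviation q v S ^ (2 * k + 1)) +
              2 * trace (samplingDeviation q v S ^ (2 * k))) := by
        calc ∑ S, samplingWeight q S * trace (samplingDeviation q v S ^ (2 * (k + 1)))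
            = ∑ j, ∑ S, samplingWeight q S * (samplingError q S j *
                (v j ⬝ᵥ (samplingDeviation q v S ^ (2 * k + 1) *ᵥ v j))) := by
              rw [Finset.sum_comm]
              refine Finset.sum_congr rfl fun S _ => ?_
              rw [← Finset.mul_sum, ← trace_samplingDeviation_mul, ← pow_succ']
              rfl
          _ ≤ ∑ j, (2 * k + 1) / (2 * β) * ∑ S, samplingWeight q S * ((samplingError q S j + 2) *
                (v j ⬝ᵥ (samplingDeviation q v S ^ (2 * k) *ᵥ v j))) :=
              Finset.sum_le_sum fun j _ =>
                sum_samplingWeight_mul_samplingError_le hq hβ j (hj j) k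
          _ = (2 * k + 1) / (2 * β) * ∑ S, samplingWeight q S * ∑ j, ((samplingError q S j + 2) *
                (v j ⬝ᵥ (samplingDeviation q v S ^ (2 * k) *ᵥ v j))) := by
              rw [← Finset.mul_sum, Finset.sum_comm]
              simp only [Finset.mul_sum]
          _ ≤ _ := by
              refine mul_le_mul_of_nonneg_left (Finset.sum_le_sum fun S _ =>
                mul_le_mul_of_nonneg_left ?_ (samplingWeight_nonneg hq S)) (by positivity)
              have hX := samplingDeviation_transpose q v S
              simp only [add_mul, Finset.sum_add_distrib]
              rw [← trace_samplingDeviation_mul, ← pow_succ', ← Finset.mul_sum]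
              have := sum_dotProduct_pow_two_mul_le hv hX k
              linarith
      set m' := ∑ S, samplingWeight q S * trace (samplingDeviation q v S ^ (2 * (k + 1)))
      have h2 : ∑ S, samplingWeight q S * (trace (samplingDeviation q v S ^ (2 * k + 1)) +
          2 * trace (samplingDeviation q v S ^ (2 * k))) ≤ 5 / 2 * m + 1 / 2 * m' := by
        rw [Finset.mul_sum, Finset.mul_sum, ← Finset.sum_add_distrib]
        refine Finset.sum_le_sum fun S _ => ?_
        have h3 := trace_pow_succ_le (samplingDeviation_transpose q v S) k
        have h4 := mul_le_mul_of_nonneg_left h3 (samplingWeight_nonneg hq S)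
        rw [show 2 * (k + 1) = 2 * k + 2 by ring]
        linarith
      have hm0' : 0 ≤ m' :=
        Finset.sum_nonneg fun S _ => mul_nonneg (samplingWeight_nonneg hq S)
          (trace_pow_two_mul_nonneg (samplingDeviation_transpose q v S) (k + 1))
      have hr : (2 * k + 1) / (2 * β) ≤ K / β := by
        rw [div_le_div_iff₀ (by positivity) hβ]
        have : (k : ℝ) + 1 ≤ K := by exact_mod_cast hk
        nlinarith
      have hr1 : K / β ≤ 1 := (div_le_one hβ).2 hKβ
      have hr0 : 0 < K / β := by positivity
      have h5 : m' ≤ K / β * (5 / 2 * m + 1 / 2 * m') :=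
        (h1.trans (mul_le_mul_of_nonneg_left h2 (by positivity))).trans
          (mul_le_mul_of_nonneg_right hr (by positivity))
      have h6 : m' ≤ 5 * (K / β) * m := by nlinarith
      calc m' ≤ 5 * (K / β) * m := h6
        _ ≤ 5 * (K / β) * ((5 * K / β) ^ k * Fintype.card n) :=
            mul_le_mul_of_nonneg_left ih (by positivity)
        _ = _ := by rw [pow_succ]; ring
  exact key K le_rfl

end BernoulliSampling

section IndependentSampling

variable {Ω ι : Type*} [MeasurableSpace Ω] [Fintype ι] [DecidableEq ι] {μ : Measure Ω}
  [IsProbabilityMeasure μ] {q : ι → ℝ} {E : ι → Set Ω}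

/-- The indices whose events occur at the outcome `ω`. -/
noncomputable def occurringIndices (E : ι → Set Ω) (ω : Ω) : Finset ι := by
  classical exact Finset.univ.filter fun x => ω ∈ E x

theorem mem_occurringIndices {ω : Ω} {x : ι} : x ∈ occurringIndices E ω ↔ ω ∈ E x := by
  simp [occurringIndices]

theorem IsIndependentSampling.real_occurringIndices_eq (h : IsIndependentSampling μ q E)
    (S : Finset ι) : μ.real {ω | occurringIndices E ω = S} = samplingWeight q S := by
  have h1 : {ω | occurringIndices E ω = S} = ⋂ x, if x ∈ S then E x else (E x)ᶜ := by
    ext ω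
    simp only [Set.mem_ofPred_eq, Set.mem_iInter, Finset.ext_iff, mem_occurringIndices]
    refine forall_congr' fun x => ?_
    by_cases hx : x ∈ S <;> simp [hx]
  have h2 : μ (⋂ x, if x ∈ S then E x else (E x)ᶜ) = ∏ x, μ (if x ∈ S then E x else (E x)ᶜ) := by
    refine iIndep.meas_iInter h.indep fun x => ?_
    have hx := MeasurableSpace.measurableSet_generateFrom (Set.mem_singleton (E x))
    split_ifs
    · exact hx
    · exact hx.compl
  rw [h1, measureReal_def, h2, ENNReal.toReal_prod, samplingWeight]
  refine Finset.prod_congr rfl fun x _ => ?_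
  rw [← measureReal_def]
  split_ifs
  · exact h.prob x
  · rw [probReal_compl_eq_one_sub (h.measurableSet x), h.prob x]

theorem IsIndependentSampling.one_sub_le_real (h : IsIndependentSampling μ q E)
    {f : Finset ι → ℝ} (hf : ∀ S, 0 ≤ f S) {δ t : ℝ} (ht : 0 < t)
    (hsum : ∑ S, samplingWeight q S * f S ≤ δ * t) :
    1 - δ ≤ μ.real {ω | f (occurringIndices E ω) ≤ t} := by
  classical
  have hw : ∀ S, 0 ≤ samplingWeight q S := fun S => by
    rw [← h.real_occurringIndices_eq]
    exact measureReal_nonneg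
  have hbad : μ.real {ω | t < f (occurringIndices E ω)} ≤ δ := by
    have h1 : {ω | t < f (occurringIndices E ω)} =
        ⋃ S ∈ Finset.univ.filter (fun S => t < f S), {ω | occurringIndices E ω = S} := by
      ext ω
      simp
    rw [h1]
    refine (measureReal_biUnion_finset_le _ _).trans ?_
    simp only [h.real_occurringIndices_eq]
    refine le_of_mul_le_mul_right (le_trans ?_ hsum) ht
    rw [Finset.sum_mul]
    refine (Finset.sum_le_sum fun S hS => ?_).trans
      (Finset.sum_le_univ_sum_of_nonneg fun S => mul_nonneg (hw S) (hf S))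
    exact mul_le_mul_of_nonneg_left (Finset.mem_filter.1 hS).2.le (hw S)
  have hu : μ.real Set.univ ≤ μ.real {ω | f (occurringIndices E ω) ≤ t} +
      μ.real {ω | t < f (occurringIndices E ω)} := by
    refine le_trans (le_of_eq ?_) (measureReal_union_le _ _)
    congr 1
    ext ω
    simp [le_or_gt]
  rw [probReal_univ] at hu
  linarith

end IndependentSampling

section Whitening

variable {m n : Type*} [Fintype m] [Fintype n] [DecidableEq m] [DecidableEq n]
  {A : Matrix m n ℝ} {c : m → ℝ}

theorem exists_eq_transpose_mul_self {P : Matrix n n ℝ} (hP : Pᵀ = P)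
    (h : ∀ x, 0 ≤ x ⬝ᵥ (P *ᵥ x)) : ∃ B : Matrix n n ℝ, P = Bᵀ * B := by
  obtain ⟨U, a, hU, -, hUa⟩ := exists_spectral_decomposition hP
  have hPU : P = U * diagonal a * Uᵀ := by simpa using hUa 1
  have ha : ∀ i, 0 ≤ a i := fun i => by
    have h1 : (Uᵀ * P * U) i i = a i := by
      have : Uᵀ * P * U = (Uᵀ * U) * diagonal a * (Uᵀ * U) := by
        rw [hPU]
        simp only [Matrix.mul_assoc]
      rw [this, hU, Matrix.one_mul, Matrix.mul_one, diagonal_apply_eq]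
    rw [← h1]
    refine (h (Uᵀ i)).trans (le_of_eq ?_)
    rw [dotProduct_mulVec]
    rfl
  refine ⟨diagonal (fun i => √(a i)) * Uᵀ, ?_⟩
  rw [transpose_mul, diagonal_transpose, transpose_transpose, Matrix.mul_assoc,
    ← Matrix.mul_assoc (diagonal _) (diagonal _), diagonal_mul_diagonal, ← Matrix.mul_assoc, hPU]
  simp only [Real.mul_self_sqrt (ha _)]

/-- Vectors `v l` that represent the weighted rows of `A` in coordinates in which the Gram matrix
`Aᵀ diag(c) A` is a projection. -/
theorem exists_whitening (hc : ∀ l, A l ≠ 0 → 0 < c l) (hc0 : ∀ l, 0 ≤ c l) :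
    ∃ (v : m → n → ℝ) (T : (n → ℝ) → n → ℝ),
      (∀ l x, (v l ⬝ᵥ T x) ^ 2 = c l * (A l ⬝ᵥ x) ^ 2) ∧
      (∀ x, T x ⬝ᵥ T x = ∑ l, c l * (A l ⬝ᵥ x) ^ 2) ∧
      (∀ l, v l ⬝ᵥ v l = c l * leverageScore A c l) ∧
      ∀ y, ∑ l, (v l ⬝ᵥ y) ^ 2 ≤ y ⬝ᵥ y := by
  have hquad : ∀ x, x ⬝ᵥ ((Aᵀ * diagonal c * A) *ᵥ x) = ∑ l, c l * (A l ⬝ᵥ x) ^ 2 := fun x => by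
    rw [dotProduct_comm, gram_mulVec_dotProduct]
    exact Finset.sum_congr rfl fun l _ => by ring
  have hrow := gram_mulVec_pseudoinverse_row hc
  have hGt := gram_transpose A c
  simp only [leverageScore]
  generalize Aᵀ * diagonal c * A = G at hquad hrow hGt
  have hP := isPseudoinverse_pseudoinverse G
  have hPt := pseudoinverse_transpose_of_isSymm hGt
  generalize pseudoinverse G = P at hP hPt hrow
  obtain ⟨B, hB⟩ : ∃ B : Matrix n n ℝ, P = Bᵀ * B := by
    refine exists_eq_transpose_mul_self hPt fun x => ?_
    have : x ⬝ᵥ (P *ᵥ x) = (P *ᵥ x) ⬝ᵥ (G *ᵥ (P *ᵥ x)) := by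
      conv_lhs => rw [← hP.mul_mul_right]
      rw [← mulVec_mulVec, ← mulVec_mulVec, dotProduct_mulVec, ← mulVec_transpose, hPt]
    rw [this, hquad]
    exact Finset.sum_nonneg fun l _ => weighted_sq_nonneg hc _ l
  have hBB : ∀ x y, (B *ᵥ x) ⬝ᵥ (B *ᵥ y) = x ⬝ᵥ (P *ᵥ y) := fun x y => by
    rw [hB, ← mulVec_mulVec, dotProduct_mulVec x, vecMul_transpose]
  refine ⟨fun l => √(c l) • (B *ᵥ A l), fun x => B *ᵥ (G *ᵥ x), fun l x => ?_, fun x => ?_,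
    fun l => ?_, fun y => ?_⟩
  · rw [smul_dotProduct, smul_eq_mul, mul_pow, Real.sq_sqrt (hc0 l), hBB]
    have : A l ⬝ᵥ (P *ᵥ (G *ᵥ x)) = A l ⬝ᵥ x := by
      rw [dotProduct_mulVec, ← mulVec_transpose, hPt, dotProduct_mulVec, ← mulVec_transpose, hGt,
        hrow]
    rw [this]
  · rw [hBB, ← hquad]
    conv_rhs => rw [← hP.mul_mul_left]
    rw [← mulVec_mulVec, ← mulVec_mulVec, dotProduct_mulVec x, ← mulVec_transpose, hGt]
  · rw [smul_dotProduct, dotProduct_smul, hBB, smul_smul, Real.mul_self_sqrt (hc0 l), smul_eq_mul]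
  · have h1 : ∑ l, (√(c l) • (B *ᵥ A l) ⬝ᵥ y) ^ 2 = y ⬝ᵥ ((B * G * Bᵀ) *ᵥ y) := by
      rw [← mulVec_mulVec, ← mulVec_mulVec, dotProduct_mulVec, ← mulVec_transpose, hquad]
      refine Finset.sum_congr rfl fun l _ => ?_
      rw [smul_dotProduct, smul_eq_mul, mul_pow, Real.sq_sqrt (hc0 l), mulVec_transpose,
        dotProduct_comm (A l), ← dotProduct_mulVec, dotProduct_comm y]
    have h2 : (B * G * Bᵀ) * (B * G * Bᵀ) = B * G * Bᵀ := by
      calc (B * G * Bᵀ) * (B * G * Bᵀ) = B * (G * (Bᵀ * B) * G) * Bᵀ := by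
            simp only [Matrix.mul_assoc]
        _ = _ := by rw [← hB, hP.mul_mul_left]
    have h3 : (B * G * Bᵀ)ᵀ = B * G * Bᵀ := by
      simp only [transpose_mul, transpose_transpose, hGt, Matrix.mul_assoc]
    rw [h1]
    generalize B * G * Bᵀ = R at h2 h3
    have h4 : (R *ᵥ y) ⬝ᵥ (R *ᵥ y) = y ⬝ᵥ (R *ᵥ y) := by
      rw [dotProduct_mulVec, ← mulVec_transpose, h3, mulVec_mulVec, h2, dotProduct_comm]
    have h5 : 0 ≤ (y - R *ᵥ y) ⬝ᵥ (y - R *ᵥ y) := Finset.sum_nonneg fun i _ => mul_self_nonneg _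
    rw [dotProduct_sub, sub_dotProduct, sub_dotProduct, h4, dotProduct_comm (R *ᵥ y) y] at h5
    linarith

end Whitening

section Stability

variable {m m' n : Type*} [Fintype m] [Fintype m'] [Fintype n] [DecidableEq m] [DecidableEq m']

/-- Lewis weights are stable: if the rows of `A'` are rescaled rows of `A` and the Gram matrix of
`A'` with the rescaled weights approximates the one of `A`, then the Lewis weights of `A'` are
close to the rescaled ones of `A`. -/
theorem IsLewisWeights.approx_of_rescaled {p : ℝ} (hp : 0 < p) (hp2 : p ≤ 2) {A : Matrix m n ℝ}
    {A' : Matrix m' n ℝ} {w : m → ℝ} {w' : m' → ℝ} (hw : IsLewisWeights p A w)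
    (hw' : IsLewisWeights p A' w') {e : m' → m} {s : m' → ℝ}
    (hs : ∀ l, A (e l) ≠ 0 → 0 < s l) (hA' : ∀ l, A' l = s l ^ (-(1 / p)) • A (e l))
    {ε : ℝ} (hε0 : 0 ≤ ε) (hε1 : ε < 1)
    (h : ∀ x, |∑ l, (s l)⁻¹ * (w (e l) ^ (1 - 2 / p) * (A (e l) ⬝ᵥ x) ^ 2) -
      ∑ l, w l ^ (1 - 2 / p) * (A l ⬝ᵥ x) ^ 2| ≤ ε * ∑ l, w l ^ (1 - 2 / p) * (A l ⬝ᵥ x) ^ 2)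
    (l : m') : (1 - ε) * w' l ≤ w (e l) / s l ∧ w (e l) / s l ≤ (1 + ε) * w' l := by
  have hne : ∀ l, A' l ≠ 0 → A (e l) ≠ 0 := fun l hl h0 => hl (by rw [hA', h0, smul_zero])
  have hu : ∀ l, A' l ≠ 0 → 0 < w (e l) / s l := fun l hl =>
    div_pos (hw.1 _ (hne l hl)) (hs l (hne l hl))
  have hc : ∀ l, A l ≠ 0 → 0 < w l ^ (1 - 2 / p) :=
    fun l hl => Real.rpow_pos_of_pos (hw.1 l hl) _
  have hc' : ∀ l, A' l ≠ 0 → 0 < (w (e l) / s l) ^ (1 - 2 / p) :=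
    fun l hl => Real.rpow_pos_of_pos (hu l hl) _
  have hsq : ∀ l x, A (e l) ≠ 0 →
      (A' l ⬝ᵥ x) ^ 2 = s l ^ (-(2 / p)) * (A (e l) ⬝ᵥ x) ^ 2 := fun l x hl => by
    rw [hA', smul_dotProduct, smul_eq_mul, mul_pow, ← Real.rpow_natCast, ← Real.rpow_mul (hs l hl).le]
    congr 2
    push_cast
    ring
  have hQ : ∀ x, ∑ l, (w (e l) / s l) ^ (1 - 2 / p) * (A' l ⬝ᵥ x) ^ 2 =
      ∑ l, (s l)⁻¹ * (w (e l) ^ (1 - 2 / p) * (A (e l) ⬝ᵥ x) ^ 2) := fun x => by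
    refine Finset.sum_congr rfl fun l _ => ?_
    by_cases hl : A (e l) = 0
    · simp [hA', hl]
    · have h1 : s l ^ (-(2 / p)) = (s l)⁻¹ * s l ^ (1 - 2 / p) := by
        rw [← Real.rpow_neg_one, ← Real.rpow_add (hs l hl)]
        congr 1
        ring
      rw [hsq l x hl, Real.div_rpow (hw.1 _ hl).le (hs l hl).le, h1]
      have := (Real.rpow_pos_of_pos (hs l hl) (1 - 2 / p)).ne'
      generalize s l ^ (1 - 2 / p) = z at this
      field_simp
  have hlow : ∀ x, (1 - ε) * ∑ l, w l ^ (1 - 2 / p) * (A l ⬝ᵥ x) ^ 2 ≤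
      ∑ l, (w (e l) / s l) ^ (1 - 2 / p) * (A' l ⬝ᵥ x) ^ 2 := fun x => by
    have := (abs_le.1 (h x)).1
    rw [hQ]
    linarith
  have hupp : ∀ x, ∑ l, (w (e l) / s l) ^ (1 - 2 / p) * (A' l ⬝ᵥ x) ^ 2 ≤
      (1 + ε) * ∑ l, w l ^ (1 - 2 / p) * (A l ⬝ᵥ x) ^ 2 := fun x => by
    have := (abs_le.1 (h x)).2
    rw [hQ]
    linarith
  have hε : 0 < 1 - ε := by linarith
  have hpow : ∀ l, A' l ≠ 0 → (w (e l) / s l) ^ (2 / p) =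
      s l ^ (-(2 / p)) * leverageScore A (fun l => w l ^ (1 - 2 / p)) (e l) := fun l hl => by
    rw [Real.div_rpow (hw.1 _ (hne l hl)).le (hs l (hne l hl)).le, hw.rpow_eq hp,
      Real.rpow_neg (hs l (hne l hl)).le]
    ring
  by_cases hl : A' l = 0
  · have hwz : w (e l) = 0 := by
      by_cases h0 : A (e l) = 0
      · exact hw.eq_zero hp h0
      · rw [hA'] at hl
        exact absurd hl (smul_ne_zero (Real.rpow_pos_of_pos (hs l h0) _).ne' h0)
    rw [hw'.eq_zero hp hl, hwz]
    simp
  constructor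
  · have := hw'.le_mul_of_le_rpow (u := fun l => w (e l) / s l) hp hp2 hu (K := (1 - ε)⁻¹)
      (fun j hj => by
        have hsp := Real.rpow_pos_of_pos (hs j (hne j hj)) (-(2 / p))
        refine leverageScore_le hc' (mul_nonneg (inv_pos.2 hε).le
          (Real.rpow_nonneg (hu j hj).le _)) fun x => ?_
        rw [hsq j x (hne j hj), hpow j hj]
        have h1 := sq_dotProduct_le_leverageScore_mul hc (e j) x
        have h2 : ∑ l, w l ^ (1 - 2 / p) * (A l ⬝ᵥ x) ^ 2 ≤
            (1 - ε)⁻¹ * ∑ l, (w (e l) / s l) ^ (1 - 2 / p) * (A' l ⬝ᵥ x) ^ 2 := by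
          rw [← div_eq_inv_mul, le_div_iff₀ hε, mul_comm]
          exact hlow x
        calc s j ^ (-(2 / p)) * (A (e j) ⬝ᵥ x) ^ 2
            ≤ s j ^ (-(2 / p)) * (leverageScore A (fun l => w l ^ (1 - 2 / p)) (e j) *
                ((1 - ε)⁻¹ * ∑ l, (w (e l) / s l) ^ (1 - 2 / p) * (A' l ⬝ᵥ x) ^ 2)) :=
              mul_le_mul_of_nonneg_left (h1.trans (mul_le_mul_of_nonneg_left h2
                (leverageScore_nonneg hc _))) hsp.le
          _ = _ := by ring) hl
    rw [← div_eq_inv_mul, le_div_iff₀ hε, mul_comm] at this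
    exact this
  · refine hw'.le_mul_of_rpow_le (u := fun l => w (e l) / s l) hp hp2 hu (by linarith)
      (fun j hj => ?_) hl
    have hsp := Real.rpow_pos_of_pos (hs j (hne j hj)) (2 / p)
    have hn := leverageScore_nonneg hc' j
    rw [hpow j hj, Real.rpow_neg (hs j (hne j hj)).le, inv_mul_le_iff₀ hsp]
    refine leverageScore_le hc (mul_nonneg hsp.le (mul_nonneg (by linarith) hn)) fun x => ?_
    have h1 := sq_dotProduct_le_leverageScore_mul hc' j x
    rw [hsq j x (hne j hj), Real.rpow_neg (hs j (hne j hj)).le, inv_mul_le_iff₀ hsp] at h1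
    calc _ ≤ _ := h1
      _ ≤ s j ^ (2 / p) * (leverageScore A' (fun l => (w (e l) / s l) ^ (1 - 2 / p)) j *
            ((1 + ε) * ∑ l, w l ^ (1 - 2 / p) * (A l ⬝ᵥ x) ^ 2)) :=
        mul_le_mul_of_nonneg_left (mul_le_mul_of_nonneg_left (hupp x) hn) hsp.le
      _ = _ := by ring

end Stability

section MainTheorem

/-- With high probability, importance sampling preserves a weighted Gram matrix up to a small
relative error. -/
theorem IsIndependentSampling.one_sub_le_real_gram {Ω ι n : Type*} [MeasurableSpace Ω]
    {μ : Measure Ω} [IsProbabilityMeasure μ] [Fintype ι] [DecidableEq ι] [Fintype n]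
    [DecidableEq n] {q : ι → ℝ} {E : ι → Set Ω}
    (h : IsIndependentSampling μ q E) (hq : ∀ x, 0 ≤ q x ∧ q x ≤ 1) {v : ι → n → ℝ}
    (hv : ∀ y, ∑ x, (v x ⬝ᵥ y) ^ 2 ≤ y ⬝ᵥ y) {β ε δ : ℝ} (hε : 0 < ε) (hε1 : ε ≤ 1 / 2)
    (hδ : 0 < δ) (hn : 2 * δ ≤ Fintype.card n)
    (hβ : 50 * Real.log (Fintype.card n / δ) ≤ β * ε ^ 2)
    (hqβ : ∀ x, q x = 1 ∨ β * (v x ⬝ᵥ v x) ≤ q x) :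
    1 - δ ≤ μ.real {ω | ∀ y, |∑ x, samplingError q (occurringIndices E ω) x * (v x ⬝ᵥ y) ^ 2| ≤
      ε * (y ⬝ᵥ y)} := by
  set N := (Fintype.card n : ℝ) with hN
  have hNδ : 2 ≤ N / δ := (le_div_iff₀ hδ).2 hn
  set L := Real.log (N / δ) with hL
  have hL0 : 0.69 < L := by
    have h1 := Real.log_le_log two_pos hNδ
    have h2 := Real.log_two_gt_d9
    linarith
  set K := ⌈L⌉₊ with hK
  have hKL : L ≤ K := Nat.le_ceil L
  have hKL' : (K : ℝ) ≤ 2.5 * L := by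
    have := Nat.ceil_lt_add_one (show 0 ≤ L by linarith)
    linarith
  have hK0 : 0 < K := Nat.ceil_pos.2 (by linarith)
  have hβ0 : 0 < β := by
    by_contra hneg
    nlinarith [mul_nonneg (neg_nonneg.2 (not_lt.1 hneg)) (sq_nonneg ε)]
  have hε2 : ε ^ 2 ≤ 1 / 4 := by nlinarith
  have hKβ : (K : ℝ) ≤ β := by nlinarith
  have he : Real.exp 1 < 3 := Real.exp_one_lt_three
  have hbase : 5 * K / β ≤ ε ^ 2 * Real.exp (-1) := by
    rw [Real.exp_neg, ← div_eq_mul_inv, div_le_div_iff₀ hβ0 (Real.exp_pos 1)]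
    have : 5 * (K : ℝ) * Real.exp 1 ≤ 5 * K * 3 :=
      mul_le_mul_of_nonneg_left he.le (by positivity)
    linarith
  have hexp : Real.exp (-K) * N ≤ δ := by
    have hNpos : 0 < N := by nlinarith
    have h1 : Real.exp (-K) ≤ (N / δ)⁻¹ := by
      rw [← Real.exp_log (show 0 < N / δ by linarith), ← Real.exp_neg]
      exact Real.exp_le_exp.2 (neg_le_neg hKL)
    calc Real.exp (-K) * N ≤ (N / δ)⁻¹ * N := mul_le_mul_of_nonneg_right h1 hNpos.le
      _ = δ := by field_simp
  have hmom := sum_samplingWeight_mul_trace_pow_le hq hv hqβ hK0 hKβ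
  have hbound : (5 * K / β) ^ K * Fintype.card n ≤ δ * ε ^ (2 * K) := by
    calc (5 * K / β) ^ K * N ≤ (ε ^ 2 * Real.exp (-1)) ^ K * N :=
          mul_le_mul_of_nonneg_right (pow_le_pow_left₀ (by positivity) hbase K) (by positivity)
      _ = ε ^ (2 * K) * (Real.exp (-K) * N) := by
        rw [mul_pow, ← pow_mul, ← Real.exp_nat_mul, mul_neg_one, mul_assoc]
      _ ≤ ε ^ (2 * K) * δ := mul_le_mul_of_nonneg_left hexp (by positivity)
      _ = _ := mul_comm _ _
  refine (h.one_sub_le_real (fun S => trace_pow_two_mul_nonneg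
    (samplingDeviation_transpose q v S) K) (by positivity) (hmom.trans hbound)).trans ?_
  refine measureReal_mono fun ω hω y => ?_
  rw [← dotProduct_samplingDeviation_mulVec]
  exact abs_dotProduct_mulVec_le_of_trace_pow_le (samplingDeviation_transpose _ _ _) hK0.ne'
    hε.le hω y

end MainTheorem

section MainTheorem

theorem IsLewisWeights.rpow_mul_leverageScore {m n : Type*} [Fintype m] [Fintype n]
    [DecidableEq m] {p : ℝ} {A : Matrix m n ℝ} {w : m → ℝ} (hw : IsLewisWeights p A w)
    (hp : 0 < p) (i : m) :
    w i ^ (1 - 2 / p) * leverageScore A (fun l => w l ^ (1 - 2 / p)) i = w i := by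
  by_cases hi : A i = 0
  · rw [hw.eq_zero hp hi]
    simp [leverageScore, hi]
  · rw [← hw.rpow_eq hp, ← Real.rpow_add (hw.1 i hi), sub_add_cancel, Real.rpow_one]

theorem rescaledSamplingMatrix_mul_apply {n d : ℕ} (p : ℝ) (q : Fin n → ℝ) (T : Finset (Fin n))
    (A : Matrix (Fin n) (Fin d) ℝ) (j : T) :
    (rescaledSamplingMatrix p q T * A) j = q j ^ (-(1 / p)) • A j := by
  ext a
  rw [Pi.smul_apply, Matrix.mul_apply]
  simp [rescaledSamplingMatrix, diagonal_apply]

theorem mainTheorem8 :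
    ∃ C : ℝ, 0 < C ∧
      ∀ (p : ℝ), 1 ≤ p → p ≤ 2 →
      ∀ (d r k : ℕ) (n : Fin r → ℕ)
        (A : ∀ i, Matrix (Fin (n i)) (Fin d) ℝ) (B : Matrix (Fin k) (Fin d) ℝ)
        (η δ β : ℝ), 0 < η → η < 1 → 0 < δ → δ < 1 → 2 * δ ≤ d →
        C * (Real.log (d / δ) / η ^ 2) ≤ β →
      ∀ (q : ∀ i, Fin (n i) → ℝ),
        (∀ i j, min (β * lewisWeights p (A i) j) 1 ≤ q i j ∧ q i j ≤ 1) →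
      ∀ (Ω : Type*) [MeasurableSpace Ω] (μ : Measure Ω) [IsProbabilityMeasure μ]
        (E : (Σ i, Fin (n i)) → Set Ω),
        IsIndependentSampling μ (fun x => q x.1 x.2) E →
      1 - δ ≤ μ.real {ω |
        let T : ∀ i, Finset (Fin (n i)) := fun i => sampledIndices (fun j => E ⟨i, j⟩) ω
        let M : Matrix ((Σ i, Fin (n i)) ⊕ Fin k) (Fin d) ℝ := vconcat A B
        let M' : Matrix ((Σ i, T i) ⊕ Fin k) (Fin d) ℝ :=
          vconcat (fun i => rescaledSamplingMatrix p (q i) (T i) * A i) B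
        (∀ (i : Fin r) (j : T i),
          (1 - η) * (lewisWeights p M (Sum.inl ⟨i, j⟩) / q i j)
              ≤ lewisWeights p M' (Sum.inl ⟨i, j⟩) ∧
          lewisWeights p M' (Sum.inl ⟨i, j⟩)
              ≤ (1 + η) * (lewisWeights p M (Sum.inl ⟨i, j⟩) / q i j)) ∧
        (∀ j : Fin k,
          (1 - η) * lewisWeights p M (Sum.inr j) ≤ lewisWeights p M' (Sum.inr j) ∧
          lewisWeights p M' (Sum.inr j) ≤ (1 + η) * lewisWeights p M (Sum.inr j))} := by
  refine ⟨200, by norm_num, ?_⟩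
  intro p hp1 hp2 d r k n A B η δ β hη hη1 hδ hδ1 hd hβ q hq Ω _ μ _ E hE
  have hp : 0 < p := by linarith
  have hlog : 0 < Real.log (d / δ) := Real.log_pos (by rw [lt_div_iff₀ hδ]; linarith)
  have hβ0 : 0 < β := lt_of_lt_of_le (by positivity) hβ
  have hA : ∀ i, IsLewisWeights p (A i) (lewisWeights p (A i)) := fun i =>
    isLewisWeights_lewisWeights hp hp2 (A i)
  have hM := isLewisWeights_lewisWeights hp hp2 (vconcat A B)
  set w := lewisWeights p (vconcat A B) with hw
  have hc : ∀ l, vconcat A B l ≠ 0 → 0 < w l ^ (1 - 2 / p) := fun l hl =>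
    Real.rpow_pos_of_pos (hM.1 l hl) _
  obtain ⟨v, R, hvR, hRR, hvv, hv⟩ := exists_whitening hc
    fun l => Real.rpow_nonneg (hM.nonneg hp l) _
  have hq0 : ∀ i j, 0 ≤ q i j := fun i j =>
    (le_min (mul_nonneg hβ0.le ((hA i).nonneg hp j)) zero_le_one).trans (hq i j).1
  have hqpos : ∀ i j, A i j ≠ 0 → 0 < q i j := fun i j hij =>
    (lt_min (mul_pos hβ0 ((hA i).1 j hij)) one_pos).trans_le (hq i j).1
  have hmono : ∀ i j, w (Sum.inl ⟨i, j⟩) ≤ lewisWeights p (A i) j := fun i j =>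
    hM.apply_le_of_submatrix (e := fun j : Fin (n i) => Sum.inl (⟨i, j⟩ : Σ i, Fin (n i)))
      (fun a b hab => by simpa using hab) hp hp2 (show IsLewisWeights p ((vconcat A B).submatrix _ id) _ from hA i) j
  refine (hE.one_sub_le_real_gram (v := fun x => v (Sum.inl x)) (β := β) (ε := η / 2)
    (fun x => ⟨hq0 _ _, (hq _ _).2⟩) (fun y => ?_) (by linarith) (by linarith) hδ (by simpa using hd)
    ?_ fun x => ?_).trans ?_
  · refine le_trans ?_ (hv y)
    rw [Fintype.sum_sum_type]
    exact le_add_of_nonneg_right (Finset.sum_nonneg fun _ _ => sq_nonneg _)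
  · rw [mul_div_assoc', div_le_iff₀ (by positivity)] at hβ
    rw [Fintype.card_fin]
    linarith
  · rcases min_le_iff.1 (hq x.1 x.2).1 with h | h
    · right
      rw [hvv, hM.rpow_mul_leverageScore hp]
      exact (mul_le_mul_of_nonneg_left (hmono x.1 x.2) hβ0.le).trans h
    · exact Or.inl (le_antisymm (hq _ _).2 h)
  refine measureReal_mono fun ω hω => ?_
  rw [Set.mem_ofPred_eq] at hω ⊢
  intro T M M'
  have hT : ∀ i j, j ∈ T i ↔ (⟨i, j⟩ : Σ i, Fin (n i)) ∈ occurringIndices E ω := fun i j => by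
    rw [mem_occurringIndices]
    simp [T, sampledIndices]
  have hM' := isLewisWeights_lewisWeights hp hp2 M'
  have happ := hM.approx_of_rescaled hp hp2 hM'
    (e := Sum.map (fun x => ⟨x.1, x.2.1⟩) id) (s := Sum.elim (fun x => q x.1 x.2) fun _ => 1)
    (ε := η / 2) (fun l hl => ?_) (fun l => ?_) (by linarith) (by linarith) (fun x => ?_)
  · have hfinal : ∀ a b : ℝ, 0 ≤ b → (1 - η / 2) * b ≤ a ∧ a ≤ (1 + η / 2) * b →
        (1 - η) * a ≤ b ∧ b ≤ (1 + η) * a := by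
      rintro a b hb ⟨h1, h2⟩
      have h3 := mul_le_mul_of_nonneg_left h2 (show 0 ≤ 1 - η by linarith)
      have h4 := mul_le_mul_of_nonneg_left h1 (show 0 ≤ 1 + η by linarith)
      have h5 : 0 ≤ η * b := mul_nonneg hη.le hb
      have h6 : 0 ≤ η * (η * b) := mul_nonneg hη.le h5
      have h7 : η * (η * b) ≤ η * b := mul_le_of_le_one_left h5 hη1.le
      constructor <;> linarith
    refine ⟨fun i j => ?_, fun j => ?_⟩
    · exact hfinal _ _ (hM'.nonneg hp _) (happ (Sum.inl ⟨i, j⟩))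
    · have := happ (Sum.inr j)
      simp only [Sum.map_inr, Sum.elim_inr, div_one, id] at this
      exact hfinal _ _ (hM'.nonneg hp _) this
  · rcases l with ⟨i, j⟩ | j
    · exact hqpos i j hl
    · exact one_pos
  · rcases l with ⟨i, j⟩ | j
    · exact rescaledSamplingMatrix_mul_apply p (q i) (T i) (A i) j
    · simp only [Sum.elim_inr, Real.one_rpow, one_smul]
      rfl
  · have h1 := hω (R x)
    simp only [hvR, hRR] at h1
    refine le_trans (le_of_eq (congrArg _ ?_)) h1
    rw [Fintype.sum_sum_type, Fintype.sum_sum_type]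
    simp only [Sum.map_inr, Sum.elim_inr, inv_one, one_mul, id, add_sub_add_right_eq_sub,
      Sum.map_inl, Sum.elim_inl]
    rw [Fintype.sum_sigma, Fintype.sum_sigma, Fintype.sum_sigma, ← Finset.sum_sub_distrib]
    refine Finset.sum_congr rfl fun i _ => ?_
    rw [Finset.sum_coe_sort (T i) fun j => (q i j)⁻¹ * (w (Sum.inl ⟨i, j⟩) ^ (1 - 2 / p) *
      (vconcat A B (Sum.inl ⟨i, j⟩) ⬝ᵥ x) ^ 2), ← Fintype.sum_ite_mem (T i),
      ← Finset.sum_sub_distrib]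
    refine Finset.sum_congr rfl fun j _ => ?_
    simp only [samplingError, ← hT]
    split_ifs <;> ring

end MainTheorem
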